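/- Let $k$ be a commutative ring and $d\ge 0$. Let $\Gamma^dP_k$ be the divided power category: its objects are the finitely generated projective $k$-modules and $\operatorname{Hom}_{\Gamma^dP_k}(V,W)=\Gamma^d(\operatorname{Hom}_k(V,W))\cong\operatorname{Hom}_{S_d}(V^{\otimes d},W^{\otimes d})$, with composition that of $S_d$-equivariant maps; it is monoidal under $V\otimes W$, using $(V\otimes W)^{\otimes d}\cong V^{\otimes d}\otimes W^{\otimes d}$. Let $\mathrm{Rep}\,\Gamma^d_k$ be the category of $k$-linear functors $\Gamma^dP_k\to k\text{-Mod}$ (strict polynomial functors of degree $d$) with all natural transformations. For $X,Y\in\mathrm{Rep}\,\Gamma^d_k$ let $$(X\,\underline{\otimes}\,Y)(U)=\int^{V,W}\operatorname{Hom}_{\Gamma^dP_k}(V\otimes W,U)\otimes_k X(V)\otimes_k Y(W)$$ be the internal tensor product ($k$-linear Day convolution), and let $\mathbb H(X,Y)(U)=\operatorname{Hom}_{\mathrm{Rep}\,\Gamma^d_k}(X,Y(U\otimes-))$ be the internal Hom. Let $$\mathrm{Sch}=\operatorname{Hom}_{\mathrm{Rep}\,\Gamma^d_k}(\otimes^d,-):\mathrm{Rep}\,\Gamma^d_k\to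 kS_d\text{-Mod}$$ be the Schur functor, where $\otimes^d$ is the functor $V\mapsto V^{\otimes d}$ and $\sigma\in S_d$ acts on $\mathrm{Sch}(X)$ by precomposition with the place permutation $\sigma^{-1}$ of $\otimes^d$. On $kS_d\text{-Mod}$ let $M\otimes N$ (over $k$, diagonal action) and $\operatorname{Hom}(M,N)=\operatorname{Hom}_k(M,N)$ (conjugation action) be the usual internal operations. The functor $\mathrm{Sch}$ has a left adjoint $\mathcal L$ and a right adjoint $\mathcal R$. For all $M,N\in kS_d\text{-Mod}$ and every $X\in\mathrm{Rep}\,\Gamma^d_k$ with $\mathrm{Sch}(X)\cong M$ there are isomorphisms $$\mathcal L(M\otimes N)\cong X\,\underline{\otimes}\,\mathcal L N,\qquad \mathcal R(\operatorname{Hom}(M,N))\cong\mathbb H(X,\mathcal R N),$$ natural in $N$. If $X=\mathcal L M$ or $X=\mathcal R M$, there are such isomorphisms natural in both $M$ and $N$; that is, naturally in $M$ and $N$, $$\mathcal L(M\otimes N)\cong\mathcal L M\,\underline{\otimes}\,\mathcal L N\cong\mathcal R M\,\underline{\otimes}\,\mathcal L N,\qquad \mathcal R(\operatorname{Hom}(M,N))\cong\mathbb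 H(\mathcal L M,\mathcal R N)\cong\mathbb H(\mathcal R M,\mathcal R N).$$ -/

import Mathlib

open CategoryTheory TensorProduct

universe u

namespace StrictPoly

noncomputable section

section TensorPowers

variable (k : Type u) [CommRing k] (d : ℕ)

/-- The place-permutation representation of the symmetric group `S_d` on `V^{⊗ d}`:
`σ` sends `v_1 ⊗ ⋯ ⊗ v_d` to the tensor whose `i`-th factor is `v_{σ⁻¹ i}`. -/
def permRep (V : Type u) [AddCommGroup V] [Module k V] :
    Representation k (Equiv.Perm (Fin d)) (⨂[k] _ : Fin d, V) where
  toFun σ := (PiTensorProduct.reindex k (fun _ : Fin d => V) σ).toLinearMap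
  map_one' := by
    ext x
    simp
    rfl
  map_mul' σ τ := by
    ext x
    simp
    rfl

@[simp]
lemma permRep_tprod (V : Type u) [AddCommGroup V] [Module k V] (σ : Equiv.Perm (Fin d))
    (v : Fin d → V) :
    permRep k d V σ (PiTensorProduct.tprod k v) =
      PiTensorProduct.tprod k (fun i => v (σ.symm i)) :=
  PiTensorProduct.reindex_tprod σ v

variable (V W : Type u) [AddCommGroup V] [Module k V] [AddCommGroup W] [Module k W]

/-- The map `V^{⊗ d} ⊗ W^{⊗ d} → (V ⊗ W)^{⊗ d}` multiplying the factors place by place. -/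
def zip : (⨂[k] _ : Fin d, V) ⊗[k] (⨂[k] _ : Fin d, W) →ₗ[k] ⨂[k] _ : Fin d, (V ⊗[k] W) :=
  TensorProduct.lift (PiTensorProduct.map₂ fun _ => TensorProduct.mk k V W)

@[simp]
lemma zip_tprod (v : Fin d → V) (w : Fin d → W) :
    zip k d V W (PiTensorProduct.tprod k v ⊗ₜ PiTensorProduct.tprod k w) =
      PiTensorProduct.tprod k (fun i => v i ⊗ₜ[k] w i) := by
  simp [zip, PiTensorProduct.map₂_tprod_tprod]

/-- Projection of the tensor algebra onto its component of degree `d`. -/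
def proj : TensorAlgebra k V →ₗ[k] ⨂[k] _ : Fin d, V :=
  DirectSum.component k ℕ (fun n => ⨂[k] _ : Fin n, V) d ∘ₗ
    (TensorAlgebra.toDirectSum (R := k) (M := V)).toLinearMap

lemma proj_prod (v : Fin d → V) :
    proj k d V (List.ofFn fun i => TensorAlgebra.ι k (v i)).prod = PiTensorProduct.tprod k v := by
  have := TensorAlgebra.toDirectSum_tensorPower_tprod (R := k) v
  rw [TensorAlgebra.tprod_apply] at this
  simp only [proj, LinearMap.comp_apply, AlgHom.toLinearMap_apply]
  rw [this]
  exact DirectSum.component.lof_self k d _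

/-- The inverse of `zip`, built with the help of tensor algebras. -/
def unzip : (⨂[k] _ : Fin d, (V ⊗[k] W)) →ₗ[k] (⨂[k] _ : Fin d, V) ⊗[k] (⨂[k] _ : Fin d, W) :=
  TensorProduct.map (proj k d V) (proj k d W) ∘ₗ
    PiTensorProduct.lift ((MultilinearMap.mkPiAlgebraFin k d
      (TensorAlgebra k V ⊗[k] TensorAlgebra k W)).compLinearMap
        fun _ => TensorProduct.map (TensorAlgebra.ι k) (TensorAlgebra.ι k))

lemma list_prod_tmul {A B : Type u} [Ring A] [Algebra k A] [Ring B] [Algebra k B] {n : ℕ}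
    (a : Fin n → A) (b : Fin n → B) :
    (List.ofFn fun i => a i ⊗ₜ[k] b i).prod = (List.ofFn a).prod ⊗ₜ[k] (List.ofFn b).prod := by
  induction n with
  | zero => simp [Algebra.TensorProduct.one_def]
  | succ n ih => simp [List.ofFn_succ, ih]

@[simp]
lemma unzip_tprod (v : Fin d → V) (w : Fin d → W) :
    unzip k d V W (PiTensorProduct.tprod k (fun i => v i ⊗ₜ[k] w i)) =
      PiTensorProduct.tprod k v ⊗ₜ PiTensorProduct.tprod k w := by
  simp [unzip, MultilinearMap.mkPiAlgebraFin_apply, list_prod_tmul, proj_prod]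

lemma ext_zip {M : Type*} [AddCommGroup M] [Module k M]
    {f g : (⨂[k] _ : Fin d, V) ⊗[k] (⨂[k] _ : Fin d, W) →ₗ[k] M}
    (h : ∀ (v : Fin d → V) (w : Fin d → W),
      f (PiTensorProduct.tprod k v ⊗ₜ PiTensorProduct.tprod k w) =
        g (PiTensorProduct.tprod k v ⊗ₜ PiTensorProduct.tprod k w)) : f = g := by
  apply TensorProduct.ext
  apply PiTensorProduct.ext
  ext v
  simp [h]

lemma zip_surjective : Function.Surjective (zip k d V W) := by
  rw [← LinearMap.range_eq_top, ← top_le_iff]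
  have hspan : ∀ _ : Fin d, Submodule.span k
      (Set.range fun p : V × W => p.1 ⊗ₜ[k] p.2) = ⊤ := fun _ => by
    rw [← TensorProduct.span_tmul_eq_top]
    congr 1
    ext; simp
  rw [← PiTensorProduct.submodule_span_eq_top (R := k) (ι := Fin d) hspan, Submodule.span_le]
  rintro _ ⟨p, rfl⟩
  exact ⟨PiTensorProduct.tprod k (fun i => (p i).1) ⊗ₜ PiTensorProduct.tprod k (fun i => (p i).2),
    zip_tprod ..⟩

lemma unzip_comp_zip : unzip k d V W ∘ₗ zip k d V W = LinearMap.id :=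
  ext_zip k d V W (by simp)

/-- The canonical isomorphism `V^{⊗ d} ⊗ W^{⊗ d} ≃ (V ⊗ W)^{⊗ d}`. -/
def zipEquiv : ((⨂[k] _ : Fin d, V) ⊗[k] (⨂[k] _ : Fin d, W)) ≃ₗ[k] ⨂[k] _ : Fin d, (V ⊗[k] W) :=
  LinearEquiv.ofBijective (zip k d V W)
    ⟨Function.LeftInverse.injective (g := unzip k d V W)
      fun x => LinearMap.congr_fun (unzip_comp_zip k d V W) x, zip_surjective k d V W⟩

@[simp]
lemma zipEquiv_tprod (v : Fin d → V) (w : Fin d → W) :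
    zipEquiv k d V W (PiTensorProduct.tprod k v ⊗ₜ PiTensorProduct.tprod k w) =
      PiTensorProduct.tprod k (fun i => v i ⊗ₜ[k] w i) :=
  zip_tprod ..

lemma zipEquiv_permRep (σ : Equiv.Perm (Fin d)) :
    (zipEquiv k d V W).toLinearMap ∘ₗ TensorProduct.map (permRep k d V σ) (permRep k d W σ) =
      permRep k d (V ⊗[k] W) σ ∘ₗ (zipEquiv k d V W).toLinearMap :=
  ext_zip k d V W (by simp)

variable {k d V W}
variable {V' V'' W' W'' : Type u} [AddCommGroup V'] [Module k V'] [AddCommGroup W'] [Module k W']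
  [AddCommGroup V''] [Module k V''] [AddCommGroup W''] [Module k W'']

/-- The map `(V ⊗ W)^{⊗ d} → (V' ⊗ W')^{⊗ d}` corresponding to `f ⊗ g` under the canonical
isomorphisms with `V^{⊗ d} ⊗ W^{⊗ d}` and `V'^{⊗ d} ⊗ W'^{⊗ d}`. -/
def zipMap (f : (⨂[k] _ : Fin d, V) →ₗ[k] ⨂[k] _ : Fin d, V')
    (g : (⨂[k] _ : Fin d, W) →ₗ[k] ⨂[k] _ : Fin d, W') :
    (⨂[k] _ : Fin d, (V ⊗[k] W)) →ₗ[k] ⨂[k] _ : Fin d, (V' ⊗[k] W') :=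
  (zipEquiv k d V' W').toLinearMap ∘ₗ TensorProduct.map f g ∘ₗ (zipEquiv k d V W).symm.toLinearMap

lemma zipMap_zipEquiv (f : (⨂[k] _ : Fin d, V) →ₗ[k] ⨂[k] _ : Fin d, V')
    (g : (⨂[k] _ : Fin d, W) →ₗ[k] ⨂[k] _ : Fin d, W') (x) :
    zipMap f g (zipEquiv k d V W x) = zipEquiv k d V' W' (TensorProduct.map f g x) := by
  simp [zipMap]

lemma ext_zipEquiv {M : Type*} [AddCommGroup M] [Module k M]
    {f g : (⨂[k] _ : Fin d, (V ⊗[k] W)) →ₗ[k] M}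
    (h : ∀ x, f (zipEquiv k d V W x) = g (zipEquiv k d V W x)) : f = g := by
  apply LinearMap.ext
  intro y
  obtain ⟨x, rfl⟩ := (zipEquiv k d V W).surjective y
  exact h x

lemma zipMap_id : zipMap (k := k) (d := d) (V := V) (W := W) .id .id = .id :=
  ext_zipEquiv fun x => by rw [zipMap_zipEquiv, TensorProduct.map_id]; simp

lemma zipMap_comp (f : (⨂[k] _ : Fin d, V) →ₗ[k] ⨂[k] _ : Fin d, V')
    (f' : (⨂[k] _ : Fin d, V') →ₗ[k] ⨂[k] _ : Fin d, V'')
    (g : (⨂[k] _ : Fin d, W) →ₗ[k] ⨂[k] _ : Fin d, W')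
    (g' : (⨂[k] _ : Fin d, W') →ₗ[k] ⨂[k] _ : Fin d, W'') :
    zipMap (f' ∘ₗ f) (g' ∘ₗ g) = zipMap f' g' ∘ₗ zipMap f g :=
  ext_zipEquiv fun x => by
    rw [LinearMap.comp_apply, zipMap_zipEquiv, zipMap_zipEquiv, zipMap_zipEquiv,
      TensorProduct.map_comp, LinearMap.comp_apply]

lemma zipMap_add_right (f : (⨂[k] _ : Fin d, V) →ₗ[k] ⨂[k] _ : Fin d, V')
    (g g' : (⨂[k] _ : Fin d, W) →ₗ[k] ⨂[k] _ : Fin d, W') :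
    zipMap f (g + g') = zipMap f g + zipMap f g' := by
  rw [zipMap, TensorProduct.map_add_right, LinearMap.add_comp, LinearMap.comp_add]
  rfl

lemma zipMap_smul_right (a : k) (f : (⨂[k] _ : Fin d, V) →ₗ[k] ⨂[k] _ : Fin d, V')
    (g : (⨂[k] _ : Fin d, W) →ₗ[k] ⨂[k] _ : Fin d, W') :
    zipMap f (a • g) = a • zipMap f g := by
  rw [zipMap, TensorProduct.map_smul_right, LinearMap.smul_comp, LinearMap.comp_smul]
  rfl

lemma zipMap_add_left (f f' : (⨂[k] _ : Fin d, V) →ₗ[k] ⨂[k] _ : Fin d, V')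
    (g : (⨂[k] _ : Fin d, W) →ₗ[k] ⨂[k] _ : Fin d, W') :
    zipMap (f + f') g = zipMap f g + zipMap f' g := by
  rw [zipMap, TensorProduct.map_add_left, LinearMap.add_comp, LinearMap.comp_add]
  rfl

lemma zipMap_smul_left (a : k) (f : (⨂[k] _ : Fin d, V) →ₗ[k] ⨂[k] _ : Fin d, V')
    (g : (⨂[k] _ : Fin d, W) →ₗ[k] ⨂[k] _ : Fin d, W') :
    zipMap (a • f) g = a • zipMap f g := by
  rw [zipMap, TensorProduct.map_smul_left, LinearMap.smul_comp, LinearMap.comp_smul]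
  rfl

lemma zipMap_permRep {f : (⨂[k] _ : Fin d, V) →ₗ[k] ⨂[k] _ : Fin d, V'}
    {g : (⨂[k] _ : Fin d, W) →ₗ[k] ⨂[k] _ : Fin d, W'} (σ : Equiv.Perm (Fin d))
    (hf : f ∘ₗ permRep k d V σ = permRep k d V' σ ∘ₗ f)
    (hg : g ∘ₗ permRep k d W σ = permRep k d W' σ ∘ₗ g) :
    zipMap f g ∘ₗ permRep k d (V ⊗[k] W) σ = permRep k d (V' ⊗[k] W') σ ∘ₗ zipMap f g :=
  ext_zipEquiv fun x => by
    have h1 := LinearMap.congr_fun (zipEquiv_permRep k d V W σ) x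
    have h2 := LinearMap.congr_fun (zipEquiv_permRep k d V' W' σ) (TensorProduct.map f g x)
    simp only [LinearMap.comp_apply, LinearEquiv.coe_coe] at h1 h2 ⊢
    rw [← h1, zipMap_zipEquiv, zipMap_zipEquiv, ← h2, ← LinearMap.comp_apply,
      ← TensorProduct.map_comp, hf, hg, TensorProduct.map_comp, LinearMap.comp_apply]

end TensorPowers

/-- Objects of the divided power category: finitely generated projective `k`-modules. -/
structure DivPow (k : Type u) [CommRing k] (_d : ℕ) where
  /-- The underlying type. -/
  carrier : Type u
  [addCommGroup : AddCommGroup carrier]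
  [module : Module k carrier]
  [finite : Module.Finite k carrier]
  [projective : Module.Projective k carrier]

namespace DivPow

attribute [instance] addCommGroup module finite projective

variable {k : Type u} [CommRing k] {d : ℕ}

/-- Morphisms `V ⟶ W` of the divided power category: elements of
`Γ^d Hom(V, W) = Hom_{S_d}(V^{⊗ d}, W^{⊗ d})`, composed as `S_d`-equivariant maps. -/
instance : Category.{u} (DivPow k d) where
  Hom V W := (permRep k d V.carrier).IntertwiningMap (permRep k d W.carrier)
  id V := .id _
  comp f g := g.comp f

/-- The `S_d`-equivariant map underlying a morphism. -/
def Hom.map {V W : DivPow k d} (f : V ⟶ W) :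
    (permRep k d V.carrier).IntertwiningMap (permRep k d W.carrier) := f

/-- The linear map underlying a morphism. -/
def Hom.lin {V W : DivPow k d} (f : V ⟶ W) :
    (⨂[k] _ : Fin d, V.carrier) →ₗ[k] (⨂[k] _ : Fin d, W.carrier) := (Hom.map f).toLinearMap

/-- An equivariant linear map as a morphism. -/
def Hom.mk {V W : DivPow k d}
    (f : (⨂[k] _ : Fin d, V.carrier) →ₗ[k] (⨂[k] _ : Fin d, W.carrier))
    (hf : ∀ σ, f ∘ₗ permRep k d V.carrier σ = permRep k d W.carrier σ ∘ₗ f) : V ⟶ W :=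
  (⟨f, hf⟩ : (permRep k d V.carrier).IntertwiningMap (permRep k d W.carrier))

@[simp]
lemma Hom.lin_mk {V W : DivPow k d}
    (f : (⨂[k] _ : Fin d, V.carrier) →ₗ[k] (⨂[k] _ : Fin d, W.carrier)) (hf) :
    Hom.lin (Hom.mk (V := V) (W := W) f hf) = f := rfl

@[ext]
lemma hom_ext {V W : DivPow k d} {f g : V ⟶ W} (h : Hom.lin f = Hom.lin g) : f = g :=
  Representation.IntertwiningMap.ext h

lemma Hom.lin_comm {V W : DivPow k d} (f : V ⟶ W) (σ : Equiv.Perm (Fin d)) :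
    Hom.lin f ∘ₗ permRep k d V.carrier σ = permRep k d W.carrier σ ∘ₗ Hom.lin f :=
  (Hom.map f).isIntertwining' σ

@[simp] lemma lin_id (V : DivPow k d) : Hom.lin (𝟙 V) = LinearMap.id := rfl

@[simp] lemma lin_comp {U V W : DivPow k d} (f : U ⟶ V) (g : V ⟶ W) :
    Hom.lin (f ≫ g) = Hom.lin g ∘ₗ Hom.lin f := rfl

instance {V W : DivPow k d} : AddCommGroup (V ⟶ W) :=
  inferInstanceAs (AddCommGroup
    ((permRep k d V.carrier).IntertwiningMap (permRep k d W.carrier)))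

instance {V W : DivPow k d} : Module k (V ⟶ W) :=
  inferInstanceAs (Module k
    ((permRep k d V.carrier).IntertwiningMap (permRep k d W.carrier)))

@[simp] lemma lin_add {V W : DivPow k d} (f g : V ⟶ W) :
    Hom.lin (f + g) = Hom.lin f + Hom.lin g := rfl

@[simp] lemma lin_smul {V W : DivPow k d} (a : k) (f : V ⟶ W) :
    Hom.lin (a • f) = a • Hom.lin f := rfl

instance : Preadditive (DivPow k d) where
  add_comp _ _ _ f f' g := by ext1; simp [LinearMap.comp_add]
  comp_add _ _ _ f g g' := by ext1; simp [LinearMap.add_comp]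

instance : Linear k (DivPow k d) where
  smul_comp _ _ _ a f g := by ext1; simp [LinearMap.comp_smul]
  comp_smul _ _ _ f a g := by ext1; simp [LinearMap.smul_comp]

/-- The tensor product of objects is the tensor product of modules. -/
abbrev tensor (V W : DivPow k d) : DivPow k d where
  carrier := V.carrier ⊗[k] W.carrier

/-- The tensor product of morphisms: under `(V ⊗ W)^{⊗ d} ≃ V^{⊗ d} ⊗ W^{⊗ d}` it is the tensor
product of the underlying equivariant maps. -/
def tensorMap {V V' W W' : DivPow k d} (f : V ⟶ V') (g : W ⟶ W') :
    tensor V W ⟶ tensor V' W' :=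
  Hom.mk (V := tensor V W) (W := tensor V' W') (zipMap (Hom.lin f) (Hom.lin g))
    fun σ => zipMap_permRep σ (Hom.lin_comm f σ) (Hom.lin_comm g σ)

lemma lin_tensorMap {V V' W W' : DivPow k d} (f : V ⟶ V') (g : W ⟶ W') :
    Hom.lin (tensorMap f g) = zipMap (Hom.lin f) (Hom.lin g) := rfl

@[simp]
lemma tensorMap_id (V W : DivPow k d) : tensorMap (𝟙 V) (𝟙 W) = 𝟙 (tensor V W) :=
  hom_ext zipMap_id

lemma tensorMap_comp {V V' V'' W W' W'' : DivPow k d} (f : V ⟶ V') (f' : V' ⟶ V'')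
    (g : W ⟶ W') (g' : W' ⟶ W'') :
    tensorMap (f ≫ f') (g ≫ g') = tensorMap f g ≫ tensorMap f' g' :=
  hom_ext (zipMap_comp ..)

lemma tensorMap_add_right {V V' W W' : DivPow k d} (f : V ⟶ V') (g g' : W ⟶ W') :
    tensorMap f (g + g') = tensorMap f g + tensorMap f g' :=
  hom_ext (zipMap_add_right ..)

lemma tensorMap_smul_right {V V' W W' : DivPow k d} (a : k) (f : V ⟶ V') (g : W ⟶ W') :
    tensorMap f (a • g) = a • tensorMap f g :=
  hom_ext (zipMap_smul_right ..)

lemma tensorMap_add_left {V V' W W' : DivPow k d} (f f' : V ⟶ V') (g : W ⟶ W') :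
    tensorMap (f + f') g = tensorMap f g + tensorMap f' g :=
  hom_ext (zipMap_add_left ..)

lemma tensorMap_smul_left {V V' W W' : DivPow k d} (a : k) (f : V ⟶ V') (g : W ⟶ W') :
    tensorMap (a • f) g = a • tensorMap f g :=
  hom_ext (zipMap_smul_left ..)

/-- The functor `U ⊗ -`. -/
def tensorLeft (U : DivPow k d) : DivPow k d ⥤ DivPow k d where
  obj V := tensor U V
  map f := tensorMap (𝟙 U) f
  map_comp f g := by rw [← tensorMap_comp, Category.id_comp]

/-- The natural transformation `U ⊗ - ⟶ U' ⊗ -` induced by `U ⟶ U'`. -/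
def tensorLeftMap {U U' : DivPow k d} (g : U ⟶ U') : tensorLeft U ⟶ tensorLeft U' where
  app V := tensorMap g (𝟙 V)
  naturality V W f := by
    change tensorMap (𝟙 U) f ≫ tensorMap g (𝟙 W) = tensorMap g (𝟙 V) ≫ tensorMap (𝟙 U') f
    rw [← tensorMap_comp, ← tensorMap_comp]
    simp

instance (U : DivPow k d) : (tensorLeft U).Additive where
  map_add := tensorMap_add_right _ _ _

instance (U : DivPow k d) : (tensorLeft U).Linear k where
  map_smul f a := tensorMap_smul_right a _ f

variable (k d) in
/-- The functor `⊗^d : V ↦ V^{⊗ d}`. -/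
def tensorPower : DivPow k d ⥤ ModuleCat.{u + 1} k where
  obj V := ModuleCat.of k (ULift.{u + 1} (⨂[k] _ : Fin d, V.carrier))
  map f := ModuleCat.ofHom
    (ULift.moduleEquiv.symm.toLinearMap ∘ₗ Hom.lin f ∘ₗ ULift.moduleEquiv.toLinearMap)

instance : (tensorPower k d).Additive where
  map_add := rfl

instance : (tensorPower k d).Linear k where
  map_smul _ _ := rfl

end DivPow

section Functors

variable (k : Type u) [CommRing k] (d : ℕ)

/-- The category of strict polynomial functors of degree `d`: `k`-linear functors from the divided
power category to `k`-modules, with all natural transformations.  The `k`-modules are taken one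
universe above the (large) category of finitely generated projective modules. -/
abbrev SPF := ObjectProperty.FullSubcategory
  (fun F : DivPow k d ⥤ ModuleCat.{u + 1} k => F.Additive ∧ F.Linear k)

variable {k d}

namespace SPF

instance (X : SPF k d) : X.obj.Additive := X.property.1
instance (X : SPF k d) : X.obj.Linear k := X.property.2

/-- Build a strict polynomial functor. -/
abbrev of (F : DivPow k d ⥤ ModuleCat.{u + 1} k) [F.Additive] [F.Linear k] : SPF k d :=
  ⟨F, inferInstance, inferInstance⟩

variable (k d) in
/-- `⊗^d` as a strict polynomial functor. -/
def tensorPower : SPF k d := of (DivPow.tensorPower k d)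

/-- The place permutation action of `S_d` on the functor `⊗^d`. -/
def perm (σ : Equiv.Perm (Fin d)) : tensorPower k d ⟶ tensorPower k d :=
  ObjectProperty.homMk
    { app V := ModuleCat.ofHom (ULift.moduleEquiv.symm.toLinearMap ∘ₗ
        permRep k d V.carrier σ ∘ₗ ULift.moduleEquiv.toLinearMap)
      naturality V W f := by
        ext x
        have := LinearMap.congr_fun (DivPow.Hom.lin_comm f σ) x.down
        exact congrArg ULift.up this.symm }

lemma perm_one : perm (1 : Equiv.Perm (Fin d)) = 𝟙 (tensorPower k d) := by
  ext V x
  exact congrArg ULift.up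
    (LinearMap.congr_fun (map_one (permRep k d V.carrier)) x.down)

lemma perm_mul (σ τ : Equiv.Perm (Fin d)) :
    perm (k := k) (σ * τ) = perm τ ≫ perm σ := by
  ext V x
  exact congrArg ULift.up
    (LinearMap.congr_fun (map_mul (permRep k d V.carrier) σ τ) x.down)

/-- The representation of `S_d` on `Hom(⊗^d, X)` coming from the right action of `S_d` on `⊗^d`,
`v ↦ σ⁻¹ v`. -/
def schurRep (X : SPF k d) :
    Representation k (Equiv.Perm (Fin d)) (tensorPower k d ⟶ X) where
  toFun σ := Linear.leftComp k X (perm σ⁻¹)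
  map_one' := by
    ext f : 1
    simp [perm_one]
  map_mul' σ τ := by
    ext f : 1
    simp [perm_mul]

variable (k d) in
/-- The Schur functor `X ↦ Hom(⊗^d, X)`. -/
def schur : SPF k d ⥤ Rep.{u + 1} k (Equiv.Perm (Fin d)) where
  obj X := Rep.of (schurRep X)
  map α := Rep.ofHom ⟨Linear.rightComp k _ α, fun σ => by
    ext f : 1
    simp [schurRep]⟩
  map_id X := by
    ext f
    simp
  map_comp α β := by
    ext f
    simp

/-- The parametrized functor `X_U = X(U ⊗ -)`. -/
abbrev param (U : DivPow k d) (X : SPF k d) : SPF k d :=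
  of (DivPow.tensorLeft U ⋙ X.obj)

/-- Functoriality of `X_U` in both variables. -/
def paramMap {U U' : DivPow k d} {X X' : SPF k d} (g : U ⟶ U') (α : X ⟶ X') :
    param U X ⟶ param U' X' :=
  ObjectProperty.homMk (DivPow.tensorLeftMap g ◫ α.hom)

lemma paramMap_app {U U' : DivPow k d} {X X' : SPF k d} (g : U ⟶ U') (α : X ⟶ X')
    (V : DivPow k d) :
    (paramMap g α).hom.app V = X.obj.map (DivPow.tensorMap g (𝟙 V)) ≫
      α.hom.app (DivPow.tensor U' V) :=
  (α.hom.naturality (DivPow.tensorMap g (𝟙 V))).symm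

lemma paramMap_id (U : DivPow k d) (X : SPF k d) : paramMap (𝟙 U) (𝟙 X) = 𝟙 (param U X) := by
  ext V : 3
  rw [paramMap_app, DivPow.tensorMap_id]
  exact (Category.comp_id _).trans (X.obj.map_id _)

lemma paramMap_comp {U U' U'' : DivPow k d} {X X' X'' : SPF k d} (g : U ⟶ U') (g' : U' ⟶ U'')
    (α : X ⟶ X') (α' : X' ⟶ X'') :
    paramMap g α ≫ paramMap g' α' = paramMap (g ≫ g') (α ≫ α') := by
  ext V : 3
  have h : DivPow.tensorMap (g ≫ g') (𝟙 V) =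
      DivPow.tensorMap g (𝟙 V) ≫ DivPow.tensorMap g' (𝟙 V) := by
    rw [← DivPow.tensorMap_comp, Category.id_comp]
  have key : (X.obj.map (DivPow.tensorMap g (𝟙 V)) ≫ α.hom.app (DivPow.tensor U' V)) ≫
      X'.obj.map (DivPow.tensorMap g' (𝟙 V)) ≫ α'.hom.app (DivPow.tensor U'' V) =
      X.obj.map (DivPow.tensorMap (g ≫ g') (𝟙 V)) ≫ α.hom.app (DivPow.tensor U'' V) ≫
        α'.hom.app (DivPow.tensor U'' V) := by
    rw [h, X.obj.map_comp, Category.assoc, Category.assoc, ← α.hom.naturality_assoc]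
  refine Eq.trans ?_ (key.trans (paramMap_app (g ≫ g') (α ≫ α') V).symm)
  exact congrArg₂ (· ≫ ·) (paramMap_app g α V) (paramMap_app g' α' V)

lemma paramMap_add {U U' : DivPow k d} {X X' : SPF k d} (g g' : U ⟶ U') (α : X ⟶ X') :
    paramMap (g + g') α = paramMap g α + paramMap g' α := by
  ext V : 3
  change _ = (paramMap g α).hom.app V + (paramMap g' α).hom.app V
  rw [paramMap_app, paramMap_app, paramMap_app, DivPow.tensorMap_add_left, Functor.map_add]
  exact Preadditive.add_comp ..

lemma paramMap_smul {U U' : DivPow k d} {X X' : SPF k d} (a : k) (g : U ⟶ U') (α : X ⟶ X') :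
    paramMap (a • g) α = a • paramMap g α := by
  ext V : 3
  change _ = a • (paramMap g α).hom.app V
  rw [paramMap_app, paramMap_app, DivPow.tensorMap_smul_left, Functor.map_smul]
  exact Linear.smul_comp ..

lemma comp_paramMap_comp {U U' U'' : DivPow k d} {X Y Y' Y'' : SPF k d} {g : U ⟶ U'}
    {g' : U' ⟶ U''} {β : Y ⟶ Y'} {β' : Y' ⟶ Y''} {g'' : U ⟶ U''} {β'' : Y ⟶ Y''}
    (f : X ⟶ param U Y) (hg : g'' = g ≫ g') (hβ : β'' = β ≫ β') :
    f ≫ paramMap g'' β'' = (f ≫ paramMap g β) ≫ paramMap g' β' := by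
  rw [Category.assoc, paramMap_comp, hg, hβ]

/-- The functor `U ↦ Hom(X, Y_U)`. -/
def internalHomFunctor (X Y : SPF k d) : DivPow k d ⥤ ModuleCat.{u + 1} k where
  obj U := ModuleCat.of k (X ⟶ param U Y)
  map g := ModuleCat.ofHom (Linear.rightComp k X (paramMap g (𝟙 Y)))
  map_id U := by
    ext f : 2
    simp [paramMap_id]
  map_comp g g' := by
    ext f : 2
    exact comp_paramMap_comp f (rfl : g ≫ g' = g ≫ g') (by simp)

instance (X Y : SPF k d) : (internalHomFunctor X Y).Additive where
  map_add {U U' g g'} := by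
    ext f : 2
    exact (congrArg (f ≫ ·) (paramMap_add g g' (𝟙 Y))).trans (Preadditive.comp_add ..)

instance (X Y : SPF k d) : (internalHomFunctor X Y).Linear k where
  map_smul {U U'} g a := by
    ext f : 2
    exact (congrArg (f ≫ ·) (paramMap_smul a g (𝟙 Y))).trans (Linear.comp_smul ..)

variable (k d) in
/-- The internal hom `ℍ(X, Y) : U ↦ Hom(X, Y_U)` as a bifunctor, where `Y_U = Y(U ⊗ -)`. -/
def internalHom : (SPF k d)ᵒᵖ ⥤ SPF k d ⥤ SPF k d where
  obj X :=
    { obj Y := of (internalHomFunctor X.unop Y)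
      map β := ObjectProperty.homMk
        { app U := ModuleCat.ofHom (Linear.rightComp k X.unop (paramMap (𝟙 U) β))
          naturality U U' g := by
            ext f : 2
            exact (comp_paramMap_comp (g'' := g) (β'' := β) f (by simp) (by simp)).symm.trans
              (comp_paramMap_comp f (by simp) (by simp)) }
      map_id Y := by
        ext U f
        exact (congrArg (CategoryStruct.comp (X := X.unop) f) (paramMap_id U Y)).trans
          (Category.comp_id (X := X.unop) f)
      map_comp β β' := by
        ext U f
        exact comp_paramMap_comp (g := 𝟙 U) (g' := 𝟙 U) (g'' := 𝟙 U) f (by simp) rfl }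
  map α :=
    { app Y := ObjectProperty.homMk
        { app U := ModuleCat.ofHom (Linear.leftComp k (param U Y) α.unop)
          naturality U U' g := by
            ext f : 2
            exact (Category.assoc α.unop f (paramMap g (𝟙 Y))).symm }
      naturality Y Y' β := by
        ext U f
        exact (Category.assoc α.unop f (paramMap (𝟙 U) β)).symm }
  map_id X := by
    ext Y U f
    exact Category.id_comp f
  map_comp α α' := by
    ext Y U f
    exact Category.assoc α'.unop α.unop f

/-! ### Day convolution -/

/-- The summand of index `(V, W)` in the Day convolution. -/
abbrev DayTerm (X Y : SPF k d) (U : DivPow k d) (p : DivPow k d × DivPow k d) : Type (u + 1) :=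
  (DivPow.tensor p.1 p.2 ⟶ U) ⊗[k] (X.obj.obj p.1 ⊗[k] Y.obj.obj p.2)

open scoped Classical in
/-- The pure tensor `h ⊗ x ⊗ y` in the direct sum over all `(V, W)`. -/
def dayPre (X Y : SPF k d) {U V W : DivPow k d} (h : DivPow.tensor V W ⟶ U)
    (x : X.obj.obj V) (y : Y.obj.obj W) : DirectSum _ (DayTerm X Y U) :=
  DirectSum.lof k _ (DayTerm X Y U) (V, W) (h ⊗ₜ (x ⊗ₜ y))

/-- The coend relations `h ∘ (a ⊗ b) ⊗ x ⊗ y = h ⊗ X(a) x ⊗ Y(b) y`. -/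
def dayRel (X Y : SPF k d) (U : DivPow k d) : Submodule k (DirectSum _ (DayTerm X Y U)) :=
  Submodule.span k {z | ∃ (V V' W W' : DivPow k d) (a : V ⟶ V') (b : W ⟶ W')
    (h : DivPow.tensor V' W' ⟶ U) (x : X.obj.obj V) (y : Y.obj.obj W),
    z = dayPre X Y (DivPow.tensorMap a b ≫ h) x y -
      dayPre X Y h (X.obj.map a x) (Y.obj.map b y)}

/-- The value at `U` of the Day convolution of `X` and `Y`, that is, the `k`-linear coend
`∫^{V, W} Hom(V ⊗ W, U) ⊗ X(V) ⊗ Y(W)`. -/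
abbrev Day (X Y : SPF k d) (U : DivPow k d) : Type (u + 1) :=
  DirectSum _ (DayTerm X Y U) ⧸ dayRel X Y U

/-- The class of `h ⊗ x ⊗ y` in the coend. -/
def dayMk (X Y : SPF k d) {U V W : DivPow k d} (h : DivPow.tensor V W ⟶ U)
    (x : X.obj.obj V) (y : Y.obj.obj W) : Day X Y U :=
  (dayRel X Y U).mkQ (dayPre X Y h x y)

open scoped Classical in
lemma dayPre_ext {X Y : SPF k d} {U : DivPow k d} {M : Type*} [AddCommGroup M] [Module k M]
    {f g : DirectSum _ (DayTerm X Y U) →ₗ[k] M}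
    (H : ∀ (V W : DivPow k d) (h : DivPow.tensor V W ⟶ U) (x : X.obj.obj V) (y : Y.obj.obj W),
      f (dayPre X Y h x y) = g (dayPre X Y h x y)) : f = g := by
  apply DirectSum.linearMap_ext
  rintro ⟨V, W⟩
  apply TensorProduct.ext
  ext h : 1
  apply TensorProduct.ext'
  intro x y
  exact H V W h x y

lemma day_ext {X Y : SPF k d} {U : DivPow k d} {M : Type*} [AddCommGroup M] [Module k M]
    {f g : Day X Y U →ₗ[k] M}
    (H : ∀ (V W : DivPow k d) (h : DivPow.tensor V W ⟶ U) (x : X.obj.obj V) (y : Y.obj.obj W),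
      f (dayMk X Y h x y) = g (dayMk X Y h x y)) : f = g :=
  Submodule.linearMap_qext _ (dayPre_ext H)

/-- The map of direct sums induced by `α : X ⟶ X'`, `β : Y ⟶ Y'` and `g : U ⟶ U'`. -/
def dayPreMap {X X' Y Y' : SPF k d} {U U' : DivPow k d} (α : X ⟶ X') (β : Y ⟶ Y') (g : U ⟶ U') :
    DirectSum _ (DayTerm X Y U) →ₗ[k] DirectSum _ (DayTerm X' Y' U') :=
  DirectSum.lmap fun p => TensorProduct.map (Linear.rightComp k _ g)
    (TensorProduct.map (α.hom.app p.1).hom (β.hom.app p.2).hom)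

@[simp]
lemma dayPreMap_dayPre {X X' Y Y' : SPF k d} {U U' V W : DivPow k d} (α : X ⟶ X') (β : Y ⟶ Y')
    (g : U ⟶ U') (h : DivPow.tensor V W ⟶ U) (x : X.obj.obj V) (y : Y.obj.obj W) :
    dayPreMap α β g (dayPre X Y h x y) =
      dayPre X' Y' (h ≫ g) (α.hom.app V x) (β.hom.app W y) := by
  classical
  exact DirectSum.lmap_lof ..

/-- Functoriality of the Day convolution in all three variables. -/
def dayMap {X X' Y Y' : SPF k d} {U U' : DivPow k d} (α : X ⟶ X') (β : Y ⟶ Y') (g : U ⟶ U') :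
    Day X Y U →ₗ[k] Day X' Y' U' :=
  (dayRel X Y U).mapQ (dayRel X' Y' U') (dayPreMap α β g) (by
    rw [dayRel, Submodule.span_le]
    rintro _ ⟨V, V', W, W', a, b, h, x, y, rfl⟩
    apply Submodule.subset_span
    refine ⟨V, V', W, W', a, b, h ≫ g, α.hom.app V x, β.hom.app W y, ?_⟩
    rw [map_sub, dayPreMap_dayPre, dayPreMap_dayPre, Category.assoc]
    congr 2
    · exact ConcreteCategory.congr_hom (α.hom.naturality a) x
    · exact ConcreteCategory.congr_hom (β.hom.naturality b) y)

@[simp]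
lemma dayMap_dayMk {X X' Y Y' : SPF k d} {U U' V W : DivPow k d} (α : X ⟶ X') (β : Y ⟶ Y')
    (g : U ⟶ U') (h : DivPow.tensor V W ⟶ U) (x : X.obj.obj V) (y : Y.obj.obj W) :
    dayMap α β g (dayMk X Y h x y) =
      dayMk X' Y' (h ≫ g) (α.hom.app V x) (β.hom.app W y) :=
  congrArg _ (dayPreMap_dayPre α β g h x y)

lemma dayMap_id (X Y : SPF k d) (U : DivPow k d) :
    dayMap (𝟙 X) (𝟙 Y) (𝟙 U) = LinearMap.id :=
  day_ext fun V W h x y => by simp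

lemma dayMap_comp {X X' X'' Y Y' Y'' : SPF k d} {U U' U'' : DivPow k d} (α : X ⟶ X')
    (α' : X' ⟶ X'') (β : Y ⟶ Y') (β' : Y' ⟶ Y'') (g : U ⟶ U') (g' : U' ⟶ U'') :
    dayMap (α ≫ α') (β ≫ β') (g ≫ g') = dayMap α' β' g' ∘ₗ dayMap α β g :=
  day_ext fun V W h x y => by simp

lemma dayMap_comp_eq {X X' X'' Y Y' Y'' : SPF k d} {U U' U'' : DivPow k d} {α : X ⟶ X'}
    {α' : X' ⟶ X''} {β : Y ⟶ Y'} {β' : Y' ⟶ Y''} {g : U ⟶ U'} {g' : U' ⟶ U''} {α'' : X ⟶ X''}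
    {β'' : Y ⟶ Y''} {g'' : U ⟶ U''} (hα : α'' = α ≫ α') (hβ : β'' = β ≫ β') (hg : g'' = g ≫ g') :
    dayMap α'' β'' g'' = dayMap α' β' g' ∘ₗ dayMap α β g := by
  rw [hα, hβ, hg, dayMap_comp]

lemma dayMk_add {X Y : SPF k d} {U V W : DivPow k d} (h h' : DivPow.tensor V W ⟶ U)
    (x : X.obj.obj V) (y : Y.obj.obj W) :
    dayMk X Y (h + h') x y = dayMk X Y h x y + dayMk X Y h' x y := by
  simp [dayMk, dayPre, TensorProduct.add_tmul]

lemma dayMk_smul {X Y : SPF k d} {U V W : DivPow k d} (a : k) (h : DivPow.tensor V W ⟶ U)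
    (x : X.obj.obj V) (y : Y.obj.obj W) :
    dayMk X Y (a • h) x y = a • dayMk X Y h x y := by
  simp [dayMk, dayPre, ← TensorProduct.smul_tmul']

lemma dayMap_add {X X' Y Y' : SPF k d} {U U' : DivPow k d} (α : X ⟶ X') (β : Y ⟶ Y')
    (g g' : U ⟶ U') : dayMap α β (g + g') = dayMap α β g + dayMap α β g' :=
  day_ext fun V W h x y => by simp [dayMk_add]

lemma dayMap_smul {X X' Y Y' : SPF k d} {U U' : DivPow k d} (α : X ⟶ X') (β : Y ⟶ Y')
    (a : k) (g : U ⟶ U') : dayMap α β (a • g) = a • dayMap α β g :=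
  day_ext fun V W h x y => by simp [dayMk_smul]

/-- The functor `U ↦ ∫^{V, W} Hom(V ⊗ W, U) ⊗ X(V) ⊗ Y(W)`. -/
def dayFunctor (X Y : SPF k d) : DivPow k d ⥤ ModuleCat.{u + 1} k where
  obj U := ModuleCat.of k (Day X Y U)
  map g := ModuleCat.ofHom (dayMap (𝟙 X) (𝟙 Y) g)
  map_id U := by rw [dayMap_id]; rfl
  map_comp g g' := by
    rw [← ModuleCat.ofHom_comp, ← dayMap_comp, Category.comp_id, Category.comp_id]

instance (X Y : SPF k d) : (dayFunctor X Y).Additive where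
  map_add {U U' g g'} := by
    ext : 1
    exact dayMap_add (𝟙 X) (𝟙 Y) g g'

instance (X Y : SPF k d) : (dayFunctor X Y).Linear k where
  map_smul {U U'} g a := by
    ext : 1
    exact dayMap_smul (𝟙 X) (𝟙 Y) a g

variable (k d) in
/-- The internal tensor product of strict polynomial functors (Day convolution) as a bifunctor. -/
def internalTensor : SPF k d ⥤ SPF k d ⥤ SPF k d where
  obj X :=
    { obj Y := of (dayFunctor X Y)
      map β := ObjectProperty.homMk
        { app U := ModuleCat.ofHom (dayMap (𝟙 X) β (𝟙 U))
          naturality U U' g := by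
            ext : 1
            exact (dayMap_comp_eq (α'' := 𝟙 X) (β'' := β) (g'' := g) (by simp) (by simp)
              (by simp)).symm.trans (dayMap_comp_eq (by simp) (by simp) (by simp)) }
      map_id Y := by
        ext U : 4
        exact dayMap_id X Y U
      map_comp β β' := by
        ext U : 4
        exact dayMap_comp_eq (by simp) rfl (by simp) }
  map α :=
    { app Y := ObjectProperty.homMk
        { app U := ModuleCat.ofHom (dayMap α (𝟙 Y) (𝟙 U))
          naturality U U' g := by
            ext : 1
            exact (dayMap_comp_eq (α'' := α) (β'' := 𝟙 Y) (g'' := g) (by simp) (by simp)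
              (by simp)).symm.trans (dayMap_comp_eq (by simp) (by simp) (by simp)) }
      naturality Y Y' β := by
        ext U : 4
        exact (dayMap_comp_eq (α'' := α) (β'' := β) (g'' := 𝟙 U) (by simp) (by simp)
          (by simp)).symm.trans (dayMap_comp_eq (by simp) (by simp) (by simp)) }
  map_id X := by
    ext Y U : 6
    exact dayMap_id X Y U
  map_comp α α' := by
    ext Y U : 6
    exact dayMap_comp_eq rfl (by simp) (by simp)

end SPF
end Functors

section Representations

variable (k : Type u) [CommRing k] (G : Type) [Group G]

/-- The Kronecker (diagonal) tensor product of representations as a bifunctor. -/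
def kronecker : Rep.{u + 1} k G ⥤ Rep.{u + 1} k G ⥤ Rep.{u + 1} k G where
  obj M :=
    { obj N := Rep.of (M.ρ.tprod N.ρ)
      map g := Rep.ofHom (Representation.IntertwiningMap.lTensor M.ρ g.hom)
      map_id N := by ext; simp
      map_comp g g' := by ext; simp }
  map f :=
    { app N := Rep.ofHom (Representation.IntertwiningMap.rTensor N.ρ f.hom)
      naturality N N' g := by ext; simp }
  map_id M := by ext; simp
  map_comp f f' := by ext; simp

/-- The representation `Hom_k(M, N)`, with `g` acting by `f ↦ g ∘ f ∘ g⁻¹`, as a bifunctor. -/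
def repHom : (Rep.{u + 1} k G)ᵒᵖ ⥤ Rep.{u + 1} k G ⥤ Rep.{u + 1} k G where
  obj M := Rep.ihom M.unop
  map {M M'} f :=
    { app N := Rep.ofHom ⟨LinearMap.lcomp k N.V f.unop.hom.toLinearMap, fun σ => by
        ext
        simp [Rep.hom_comm_apply]⟩
      naturality N N' g := by ext; rfl }
  map_id M := by ext; rfl
  map_comp f f' := by ext; rfl

end Representations

end
end StrictPoly

namespace StrictPoly

noncomputable section

/-! ### Projectivity of tensor powers. -/

section TensorPowers

variable (k : Type u) [CommRing k] (d : ℕ)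

/-! Everything rests on one tensor, t = e_1 ⊗ ⋯ ⊗ e_d in (k^d)^{⊗ d} (`genVec`), and the functional
τ reading off its coefficient (`genDual`). The place permutations move t freely, and τ(σ t) is 1 for
σ = 1 and 0 otherwise. Summing the conjugates of a rank one map x ↦ ξ(x) w gives a morphism `trace ξ
w` of the divided power category, and the orthogonality of τ to the other translates of t gives
`trace τ v` (t) = v and τ ∘ `trace ξ t` = ξ (`trace_genVec`, `genDual_trace`). The first identity
makes V ↦ V^{⊗ d} a retract of the representable functor at k^d, so a transformation f : ⊗^d ⟶ X is
recovered from f(t) (`coev_ev`); conversely x ∈ X(V) and ξ ∈ (V^{⊗ d})^* yield the transformation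
`coev x ξ`. No division by d! occurs.

The adjoints are explicit: the left one is N ↦ (V^{⊗ d} ⊗ N)_{S_d}, the right one is N ↦
Hom_{S_d}((V^{⊗ d})^*, N). The theorem follows from two projection formulas, natural in X and N:
left(Sch X ⊗ N) ≅ X ⊗ left N (`leftTensorIso`) and right(Hom(Sch X, N)) ≅ ℍ(X, right N)
(`rightHomIso`). For the first, u ⊗ f ⊗ n goes to the class of `trace (τ ⊗ τ) u` ⊗ f(t) ⊗ (t ⊗ n);
in the other direction h ⊗ x ⊗ (w ⊗ n) is contracted by writing h(- ⊗ w) as a sum of rank one maps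
ξ(-) u and taking the sum of u ⊗ `coev x ξ` ⊗ n. For the second, α and g correspond when α(x)(ξ ⊗ η)
= g(ξ)(`coev x η`). Both need V^{⊗ d} finitely generated projective, so that Hom(V^{⊗ d}, W^{⊗ d})
is (V^{⊗ d})^* ⊗ W^{⊗ d} and functionals on (U ⊗ V)^{⊗ d} are sums of products.

If Sch X ≅ M, the formulas become those wanted, naturally in N. Naturality in M as well requires Sch
∘ F ≅ id for F = L and F = R: the unit of the left adjunction is invertible by a contraction against
τ (`bijective_leftUnit`), and in an adjoint triple this is equivalent to invertibility of the counit
of the right adjunction. Uniqueness of adjoints passes from the explicit functors to arbitrary L and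
R. -/

instance projective_piTensorProduct (V : Type u) [AddCommGroup V] [Module k V]
    [Module.Finite k V] [Module.Projective k V] :
    Module.Projective k (⨂[k] _ : Fin d, V) := by
  -- A splitting V → k^n → V of the identity stays a splitting after applying the d-th tensor power,
  -- and (k^n)^{⊗ d} is free.
  obtain ⟨n, p, i, -, -, h⟩ := Module.Finite.exists_comp_eq_id_of_projective k V
  have : Module.Free k (⨂[k] _ : Fin d, (Fin n → k)) :=
    .of_basis (Basis.piTensorProduct fun _ : Fin d => Pi.basisFun k (Fin n))
  refine Module.Projective.of_split (PiTensorProduct.map fun _ => i)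
    (PiTensorProduct.map fun _ => p) ?_
  rw [← PiTensorProduct.map_comp, h, PiTensorProduct.map_id]

end TensorPowers

/-! ### Symmetrized rank one maps and products of functionals. -/

namespace DivPow

variable {k : Type u} [CommRing k] {d : ℕ}

/-- The tensor power `V^{⊗ d}`. -/
abbrev pow (V : DivPow k d) : Type u := ⨂[k] _ : Fin d, V.carrier

/-- The place permutations of `V^{⊗ d}`. -/
abbrev rho (V : DivPow k d) : Representation k (Equiv.Perm (Fin d)) V.pow :=
  permRep k d V.carrier

lemma lin_rho {V W : DivPow k d} (g : V ⟶ W) (σ : Equiv.Perm (Fin d)) (v : V.pow) :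
    Hom.lin g (V.rho σ v) = W.rho σ (Hom.lin g v) :=
  LinearMap.congr_fun (Hom.lin_comm g σ) v

/-- `Hom.lin` as a linear map. -/
def linₗ (V W : DivPow k d) : (V ⟶ W) →ₗ[k] V.pow →ₗ[k] W.pow where
  toFun f := Hom.lin f
  map_add' _ _ := rfl
  map_smul' _ _ := rfl

/-- The equivariant map `V^{⊗ d} → W^{⊗ d}` obtained from the rank one map `x ↦ ξ x • w` by
summing its conjugates under place permutations. -/
def trace {V W : DivPow k d} (ξ : Module.Dual k V.pow) (w : W.pow) : V ⟶ W :=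
  Hom.mk (∑ σ : Equiv.Perm (Fin d), (ξ ∘ₗ V.rho σ⁻¹).smulRight (W.rho σ w)) fun π => by
    refine LinearMap.ext fun x => ?_
    simp only [LinearMap.comp_apply, LinearMap.sum_apply, LinearMap.smulRight_apply, map_sum,
      map_smul]
    -- Reindexing by σ ↦ π⁻¹σ: the term ξ(σ⁻¹πx) • σw equals ξ((π⁻¹σ)⁻¹x) • π(π⁻¹σ)w.
    refine Fintype.sum_equiv (Equiv.mulLeft π⁻¹) _ _ fun σ => ?_
    simp only [Equiv.coe_mulLeft, mul_inv_rev, inv_inv, map_mul, Module.End.mul_apply]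
    rw [← Module.End.mul_apply (W.rho π), ← map_mul, mul_inv_cancel, map_one]
    rfl

lemma lin_trace {V W : DivPow k d} (ξ : Module.Dual k V.pow) (w : W.pow) (x : V.pow) :
    Hom.lin (trace ξ w) x =
      ∑ σ : Equiv.Perm (Fin d), ξ (V.rho σ⁻¹ x) • W.rho σ w := by
  simp [trace]

lemma hom_ext' {V W : DivPow k d} {f g : V ⟶ W} (h : ∀ x, Hom.lin f x = Hom.lin g x) : f = g :=
  hom_ext (LinearMap.ext h)

lemma trace_comp {V W W' : DivPow k d} (ξ : Module.Dual k V.pow) (w : W.pow) (g : W ⟶ W') :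
    trace ξ w ≫ g = trace ξ (Hom.lin g w) :=
  hom_ext' fun x => by simp [lin_trace, lin_rho]

lemma comp_trace {V V' W : DivPow k d} (g : V' ⟶ V) (ξ : Module.Dual k V.pow) (w : W.pow) :
    g ≫ trace ξ w = trace (ξ ∘ₗ Hom.lin g) w :=
  hom_ext' fun x => by simp [lin_trace, lin_rho]

/-- Conjugating the rank one map does not change the sum over its conjugates. This lets permutations
pass between the functional and the vector. -/
lemma trace_rho {V W : DivPow k d} (ξ : Module.Dual k V.pow) (w : W.pow)
    (σ : Equiv.Perm (Fin d)) : trace (ξ ∘ₗ V.rho σ) w = trace ξ (W.rho σ w) :=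
  hom_ext' fun x => by
    rw [lin_trace, lin_trace]
    refine Fintype.sum_equiv (Equiv.mulRight σ⁻¹) _ _ fun π => ?_
    simp only [Equiv.coe_mulRight, mul_inv_rev, inv_inv, map_mul, Module.End.mul_apply,
      LinearMap.comp_apply]
    rw [← Module.End.mul_apply (W.rho σ⁻¹), ← map_mul, inv_mul_cancel, map_one]
    rfl

/-- `trace` as a bilinear map. -/
def traceₗ (V W : DivPow k d) : Module.Dual k V.pow →ₗ[k] W.pow →ₗ[k] (V ⟶ W) :=
  LinearMap.mk₂ k trace
    (fun ξ ξ' w => hom_ext' fun x => by simp [lin_trace, add_smul, Finset.sum_add_distrib])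
    (fun a ξ w => hom_ext' fun x => by simp [lin_trace, mul_smul, Finset.smul_sum])
    (fun ξ w w' => hom_ext' fun x => by simp [lin_trace, Finset.sum_add_distrib])
    (fun a ξ w => hom_ext' fun x => by simp [lin_trace, Finset.smul_sum, smul_comm a])

@[simp]
lemma traceₗ_apply {V W : DivPow k d} (ξ : Module.Dual k V.pow) (w : W.pow) :
    traceₗ V W ξ w = trace ξ w := rfl

/-- The product `ξ ⊗ η` as a functional on `(V ⊗ W)^{⊗ d}`. -/
def dualTensor {V W : DivPow k d} (ξ : Module.Dual k V.pow) (η : Module.Dual k W.pow) :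
    Module.Dual k (tensor V W).pow :=
  LinearMap.mul' k k ∘ₗ TensorProduct.map ξ η ∘ₗ (zipEquiv k d V.carrier W.carrier).symm.toLinearMap

@[simp]
lemma dualTensor_zipEquiv {V W : DivPow k d} (ξ : Module.Dual k V.pow) (η : Module.Dual k W.pow)
    (x : V.pow) (y : W.pow) :
    dualTensor ξ η (zipEquiv k d V.carrier W.carrier (x ⊗ₜ y)) = ξ x * η y := by
  simp [dualTensor]

/-- `dualTensor` as a bilinear map. -/
def dualTensorₗ (V W : DivPow k d) :
    Module.Dual k V.pow →ₗ[k] Module.Dual k W.pow →ₗ[k] Module.Dual k (tensor V W).pow :=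
  LinearMap.mk₂ k dualTensor
    (fun ξ ξ' η => by
      rw [dualTensor, TensorProduct.map_add_left, LinearMap.add_comp, LinearMap.comp_add]; rfl)
    (fun a ξ η => by
      rw [dualTensor, TensorProduct.map_smul_left, LinearMap.smul_comp, LinearMap.comp_smul]; rfl)
    (fun ξ η η' => by
      rw [dualTensor, TensorProduct.map_add_right, LinearMap.add_comp, LinearMap.comp_add]; rfl)
    (fun a ξ η => by
      rw [dualTensor, TensorProduct.map_smul_right, LinearMap.smul_comp, LinearMap.comp_smul]; rfl)

lemma ext_zipEquiv_tmul {V W : DivPow k d} {M : Type*} [AddCommGroup M] [Module k M]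
    {f g : (tensor V W).pow →ₗ[k] M}
    (h : ∀ (x : V.pow) (y : W.pow), f (zipEquiv k d V.carrier W.carrier (x ⊗ₜ y)) =
      g (zipEquiv k d V.carrier W.carrier (x ⊗ₜ y))) : f = g := by
  apply ext_zipEquiv
  have : f ∘ₗ (zipEquiv k d V.carrier W.carrier).toLinearMap =
      g ∘ₗ (zipEquiv k d V.carrier W.carrier).toLinearMap := TensorProduct.ext' h
  exact LinearMap.congr_fun this

lemma lin_tensorMap_zipEquiv {V V' W W' : DivPow k d} (f : V ⟶ V') (g : W ⟶ W')
    (x : V.pow) (y : W.pow) :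
    Hom.lin (tensorMap f g) (zipEquiv k d V.carrier W.carrier (x ⊗ₜ y)) =
      zipEquiv k d V'.carrier W'.carrier (Hom.lin f x ⊗ₜ Hom.lin g y) :=
  (zipMap_zipEquiv ..).trans (by simp)

lemma rho_zipEquiv {V W : DivPow k d} (σ : Equiv.Perm (Fin d)) (x : V.pow) (y : W.pow) :
    (tensor V W).rho σ (zipEquiv k d V.carrier W.carrier (x ⊗ₜ y)) =
      zipEquiv k d V.carrier W.carrier (V.rho σ x ⊗ₜ W.rho σ y) :=
  (LinearMap.congr_fun (zipEquiv_permRep k d V.carrier W.carrier σ) (x ⊗ₜ y)).symm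

lemma dualTensor_comp_tensorMap {V V' W W' : DivPow k d} (f : V ⟶ V') (g : W ⟶ W')
    (ξ : Module.Dual k V'.pow) (η : Module.Dual k W'.pow) :
    dualTensor ξ η ∘ₗ Hom.lin (tensorMap f g) =
      dualTensor (ξ ∘ₗ Hom.lin f) (η ∘ₗ Hom.lin g) :=
  ext_zipEquiv_tmul fun x y => by
    rw [LinearMap.comp_apply, lin_tensorMap_zipEquiv, dualTensor_zipEquiv, dualTensor_zipEquiv]
    rfl

lemma dualTensor_comp_rho {V W : DivPow k d} (σ : Equiv.Perm (Fin d))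
    (ξ : Module.Dual k V.pow) (η : Module.Dual k W.pow) :
    dualTensor ξ η ∘ₗ (tensor V W).rho σ = dualTensor (ξ ∘ₗ V.rho σ) (η ∘ₗ W.rho σ) :=
  ext_zipEquiv_tmul fun x y => by
    rw [LinearMap.comp_apply, rho_zipEquiv, dualTensor_zipEquiv, dualTensor_zipEquiv]
    rfl

/-! ### The generator e_1 ⊗ ⋯ ⊗ e_d and its coordinate functional. -/

variable (k d) in
/-- The free module of rank `d`. -/
abbrev gen : DivPow k d where
  carrier := Fin d → k

variable (k d) in
/-- The tensor `e_1 ⊗ ⋯ ⊗ e_d` of the standard basis vectors. -/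
def genVec : (gen k d).pow :=
  PiTensorProduct.tprod k fun i => (Pi.single i 1 : Fin d → k)

variable (k d) in
/-- The coefficient of `e_1 ⊗ ⋯ ⊗ e_d`. -/
def genDual : Module.Dual k (gen k d).pow :=
  PiTensorProduct.lift ((MultilinearMap.mkPiAlgebra k (Fin d) k).compLinearMap
    fun i => (LinearMap.proj i : (Fin d → k) →ₗ[k] k))

/-- The value is the product over i of the i-th coordinate of e_{σ⁻¹ i}, which vanishes as soon as σ
moves some i. This orthogonality collapses every sum over S_d below to its term at σ = 1. -/
lemma genDual_rho_genVec (σ : Equiv.Perm (Fin d)) :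
    genDual k d ((gen k d).rho σ (genVec k d)) = if σ = 1 then 1 else 0 := by
  have h : genDual k d ((gen k d).rho σ (genVec k d)) =
      ∏ i, (Pi.single (σ.symm i) 1 : Fin d → k) i := by
    rw [genVec, rho, permRep_tprod]
    exact PiTensorProduct.lift.tprod _
  rw [h]
  split_ifs with hσ
  · subst hσ
    exact Finset.prod_eq_one fun i _ => Pi.single_eq_same i 1
  · obtain ⟨i, hi⟩ : ∃ i, σ i ≠ i := by
      by_contra! hc
      exact hσ (Equiv.ext hc)
    refine Finset.prod_eq_zero (Finset.mem_univ i) (Pi.single_eq_of_ne (fun hc => hi ?_) 1)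
    exact (σ.eq_symm_apply.1 hc)

/-- Every functional is thus the pullback of the single functional `genDual` along a morphism to
k^d, so naturality reduces questions about all ξ to `genDual`. -/
lemma genDual_trace {V : DivPow k d} (ξ : Module.Dual k V.pow) :
    genDual k d ∘ₗ Hom.lin (trace ξ (genVec k d)) = ξ := by
  refine LinearMap.ext fun v => ?_
  rw [LinearMap.comp_apply, lin_trace, map_sum, Finset.sum_eq_single 1]
  · simp only [map_smul, genDual_rho_genVec]
    simp
  · intro σ _ hσ
    rw [map_smul, genDual_rho_genVec, if_neg hσ, smul_zero]
  · simp

/-- Dually, every tensor is the image of the generator under a morphism out of k^d. -/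
lemma trace_genVec {V : DivPow k d} (v : V.pow) :
    Hom.lin (trace (genDual k d) v) (genVec k d) = v := by
  rw [lin_trace, Finset.sum_eq_single 1]
  · simp only [genDual_rho_genVec]
    simp
  · intro σ _ hσ
    rw [genDual_rho_genVec, if_neg (inv_ne_one.2 hσ), zero_smul]
  · simp

end DivPow

/-! ### Transformations out of ⊗^d. -/

namespace SPF

open DivPow

variable {k : Type u} [CommRing k] {d : ℕ}

/-- The value of a transformation `⊗^d ⟶ X` at a tensor. -/
def ev {X : SPF k d} (f : tensorPower k d ⟶ X) (V : DivPow k d) : V.pow →ₗ[k] X.obj.obj V :=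
  (f.hom.app V).hom ∘ₗ ULift.moduleEquiv.symm.toLinearMap

lemma hom_ext_ev {X : SPF k d} {f g : tensorPower k d ⟶ X}
    (h : ∀ (V : DivPow k d) (v : V.pow), ev f V v = ev g V v) : f = g := by
  ext V v
  exact h V v.down

lemma ev_lin {X : SPF k d} (f : tensorPower k d ⟶ X) {V W : DivPow k d} (g : V ⟶ W)
    (v : V.pow) : ev f W (Hom.lin g v) = X.obj.map g (ev f V v) :=
  ConcreteCategory.congr_hom (f.hom.naturality g) (ULift.up v)

lemma ev_schurRep {X : SPF k d} (f : tensorPower k d ⟶ X) (σ : Equiv.Perm (Fin d))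
    (V : DivPow k d) (v : V.pow) : ev (schurRep X σ f) V v = ev f V (V.rho σ⁻¹ v) := rfl

lemma ev_add {X : SPF k d} (f g : tensorPower k d ⟶ X) (V : DivPow k d) (v : V.pow) :
    ev (f + g) V v = ev f V v + ev g V v := rfl

lemma ev_smul {X : SPF k d} (a : k) (f : tensorPower k d ⟶ X) (V : DivPow k d) (v : V.pow) :
    ev (a • f) V v = a • ev f V v := rfl

/-- `ev` as a bilinear map. -/
def evₗ (X : SPF k d) (V : DivPow k d) :
    (tensorPower k d ⟶ X) →ₗ[k] V.pow →ₗ[k] X.obj.obj V where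
  toFun f := ev f V
  map_add' _ _ := rfl
  map_smul' _ _ := rfl

/-- A family of linear maps `V^{⊗ d} → X(V)`, natural in `V`, as a morphism. -/
def homOfFamily {X : SPF k d} (φ : ∀ V : DivPow k d, V.pow →ₗ[k] X.obj.obj V)
    (hφ : ∀ {V W : DivPow k d} (g : V ⟶ W) (v : V.pow), φ W (Hom.lin g v) = X.obj.map g (φ V v)) :
    tensorPower k d ⟶ X :=
  ObjectProperty.homMk
    { app V := ModuleCat.ofHom (φ V ∘ₗ ULift.moduleEquiv.toLinearMap)
      naturality V W g := by
        ext v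
        exact hφ g v.down }

/-- Evaluation of the action on morphisms of `X` at an element. -/
def mapₗ (X : SPF k d) (V W : DivPow k d) : X.obj.obj V →ₗ[k] (V ⟶ W) →ₗ[k] X.obj.obj W :=
  LinearMap.mk₂ k (fun x g => X.obj.map g x) (by simp) (by simp)
    (fun x g h => by rw [Functor.map_add]; rfl) (fun a x g => by rw [Functor.map_smul]; rfl)

/-- The transformation `v ↦ X(trace ξ v) x`. -/
def coev {X : SPF k d} {V : DivPow k d} (x : X.obj.obj V) (ξ : Module.Dual k V.pow) :
    tensorPower k d ⟶ X :=
  homOfFamily (fun W => mapₗ X V W x ∘ₗ traceₗ V W ξ) fun {W W'} g v => by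
    change X.obj.map (trace ξ (Hom.lin g v)) x = X.obj.map g (X.obj.map (trace ξ v) x)
    rw [← trace_comp, Functor.map_comp]
    rfl

lemma ev_coev {X : SPF k d} {V : DivPow k d} (x : X.obj.obj V) (ξ : Module.Dual k V.pow)
    (W : DivPow k d) (w : W.pow) : ev (coev x ξ) W w = X.obj.map (trace ξ w) x := rfl

/-- Dinaturality of `coev` in V, used later both for naturality of the right adjoint's transposes
and for compatibility with the coend relations. -/
lemma coev_map {X : SPF k d} {V W : DivPow k d} (x : X.obj.obj V) (g : V ⟶ W)
    (ξ : Module.Dual k W.pow) : coev (X.obj.map g x) ξ = coev x (ξ ∘ₗ Hom.lin g) :=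
  hom_ext_ev fun U u => by
    rw [ev_coev, ev_coev, ← comp_trace, Functor.map_comp]
    rfl

lemma schurRep_coev {X : SPF k d} {V : DivPow k d} (x : X.obj.obj V) (ξ : Module.Dual k V.pow)
    (σ : Equiv.Perm (Fin d)) : schurRep X σ (coev x ξ) = coev x (ξ ∘ₗ V.rho σ⁻¹) :=
  hom_ext_ev fun W w => by
    rw [ev_schurRep, ev_coev, ev_coev, trace_rho]

/-- `coev` as a bilinear map. -/
def coevₗ (X : SPF k d) (V : DivPow k d) :
    X.obj.obj V →ₗ[k] Module.Dual k V.pow →ₗ[k] (tensorPower k d ⟶ X) :=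
  LinearMap.mk₂ k coev
    (fun x y ξ => hom_ext_ev fun W w => by rw [ev_add]; exact map_add (X.obj.map (trace ξ w)).hom x y)
    (fun a x ξ => hom_ext_ev fun W w => by rw [ev_smul]; exact map_smul (X.obj.map (trace ξ w)).hom a x)
    (fun x ξ η => hom_ext_ev fun W w => by
      change mapₗ X V W x (traceₗ V W (ξ + η) w) = _
      simp [ev_add, ev_coev, mapₗ])
    (fun a x ξ => hom_ext_ev fun W w => by
      change mapₗ X V W x (traceₗ V W (a • ξ) w) = _
      simp [ev_smul, ev_coev, mapₗ])

@[simp]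
lemma coevₗ_apply {X : SPF k d} {V : DivPow k d} (x : X.obj.obj V) (ξ : Module.Dual k V.pow) :
    coevₗ X V x ξ = coev x ξ := rfl

/-- The value of a transformation `⊗^d ⟶ X` at the generator `e_1 ⊗ ⋯ ⊗ e_d` determines it. -/
lemma coev_ev {X : SPF k d} (f : tensorPower k d ⟶ X) :
    coev (ev f (gen k d) (genVec k d)) (genDual k d) = f :=
  hom_ext_ev fun W w => by
    rw [ev_coev, ← ev_lin, trace_genVec]

/-! ### The left adjoint -/

variable (k d) in
/-- The representation `V^{⊗ d} ⊗ N`. -/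
abbrev powTensor (V : DivPow k d) (N : Rep.{u + 1} k (Equiv.Perm (Fin d))) :
    Representation k (Equiv.Perm (Fin d)) (V.pow ⊗[k] N.V) :=
  V.rho.tprod N.ρ

/-- The class of `v ⊗ n` in the coinvariants of `V^{⊗ d} ⊗ N`. -/
def leftMk {V : DivPow k d} {N : Rep.{u + 1} k (Equiv.Perm (Fin d))} :
    V.pow →ₗ[k] N.V →ₗ[k] (powTensor k d V N).Coinvariants :=
  (TensorProduct.mk k V.pow N.V).compr₂ (Representation.Coinvariants.mk _)

lemma leftMk_rho {V : DivPow k d} {N : Rep.{u + 1} k (Equiv.Perm (Fin d))}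
    (σ : Equiv.Perm (Fin d)) (v : V.pow) (n : N.V) :
    leftMk (V.rho σ v) (N.ρ σ n) = leftMk (N := N) v n :=
  Representation.Coinvariants.mk_self_apply (powTensor k d V N) σ (v ⊗ₜ n)

lemma leftMk_rho_left {V : DivPow k d} {N : Rep.{u + 1} k (Equiv.Perm (Fin d))}
    (σ : Equiv.Perm (Fin d)) (v : V.pow) (n : N.V) :
    leftMk (V.rho σ v) n = leftMk (N := N) v (N.ρ σ⁻¹ n) := by
  rw [← leftMk_rho σ v]
  simp

lemma left_ext {V : DivPow k d} {N : Rep.{u + 1} k (Equiv.Perm (Fin d))} {M : Type*}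
    [AddCommGroup M] [Module k M] {f g : (powTensor k d V N).Coinvariants →ₗ[k] M}
    (h : ∀ v n, f (leftMk v n) = g (leftMk v n)) : f = g :=
  Representation.Coinvariants.hom_ext (TensorProduct.ext' h)

/-- Linear maps out of the coinvariants of `V^{⊗ d} ⊗ N`. -/
def leftLift {V : DivPow k d} {N : Rep.{u + 1} k (Equiv.Perm (Fin d))} {M : Type*}
    [AddCommGroup M] [Module k M] (f : V.pow →ₗ[k] N.V →ₗ[k] M)
    (hf : ∀ σ v n, f (V.rho σ v) (N.ρ σ n) = f v n) :
    (powTensor k d V N).Coinvariants →ₗ[k] M :=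
  Representation.Coinvariants.lift _ (TensorProduct.lift f)
    fun σ => TensorProduct.ext' fun v n => hf σ v n

@[simp]
lemma leftLift_leftMk {V : DivPow k d} {N : Rep.{u + 1} k (Equiv.Perm (Fin d))} {M : Type*}
    [AddCommGroup M] [Module k M] (f : V.pow →ₗ[k] N.V →ₗ[k] M) (hf) (v : V.pow) (n : N.V) :
    leftLift (N := N) f hf (leftMk v n) = f v n := rfl

/-- Functoriality of the coinvariants of `V^{⊗ d} ⊗ N`. -/
def leftMap {V V' : DivPow k d} {N N' : Rep.{u + 1} k (Equiv.Perm (Fin d))} (g : V ⟶ V')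
    (φ : N ⟶ N') : (powTensor k d V N).Coinvariants →ₗ[k] (powTensor k d V' N').Coinvariants :=
  leftLift (leftMk.compl₁₂ (Hom.lin g) φ.hom.toLinearMap) fun σ v n => by
    have h : φ.hom.toLinearMap (N.ρ σ n) = N'.ρ σ (φ.hom.toLinearMap n) :=
      Rep.hom_comm_apply φ σ n
    rw [LinearMap.compl₁₂_apply, lin_rho, h, leftMk_rho]
    rfl

@[simp]
lemma leftMap_leftMk {V V' : DivPow k d} {N N' : Rep.{u + 1} k (Equiv.Perm (Fin d))} (g : V ⟶ V')
    (φ : N ⟶ N') (v : V.pow) (n : N.V) :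
    leftMap g φ (leftMk v n) = leftMk (Hom.lin g v) (φ.hom n) := rfl

lemma leftMap_id (V : DivPow k d) (N : Rep.{u + 1} k (Equiv.Perm (Fin d))) :
    leftMap (𝟙 V) (𝟙 N) = LinearMap.id :=
  left_ext fun v n => by simp

lemma leftMap_comp {V V' V'' : DivPow k d} {N N' N'' : Rep.{u + 1} k (Equiv.Perm (Fin d))}
    {g : V ⟶ V'} {g' : V' ⟶ V''} {φ : N ⟶ N'} {φ' : N' ⟶ N''} {g'' : V ⟶ V''} {φ'' : N ⟶ N''}
    (hg : g'' = g ≫ g') (hφ : φ'' = φ ≫ φ') :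
    leftMap g'' φ'' = leftMap g' φ' ∘ₗ leftMap g φ :=
  left_ext fun v n => by simp [hg, hφ]

lemma leftMap_add {V V' : DivPow k d} {N N' : Rep.{u + 1} k (Equiv.Perm (Fin d))} (g g' : V ⟶ V')
    (φ : N ⟶ N') : leftMap (g + g') φ = leftMap g φ + leftMap g' φ :=
  left_ext fun v n => by simp

lemma leftMap_smul {V V' : DivPow k d} {N N' : Rep.{u + 1} k (Equiv.Perm (Fin d))} (a : k)
    (g : V ⟶ V') (φ : N ⟶ N') : leftMap (a • g) φ = a • leftMap g φ :=
  left_ext fun v n => by simp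

/-- The functor `V ↦ V^{⊗ d} ⊗_{S_d} N`. -/
def leftFunctor (N : Rep.{u + 1} k (Equiv.Perm (Fin d))) : DivPow k d ⥤ ModuleCat.{u + 1} k where
  obj V := ModuleCat.of k (powTensor k d V N).Coinvariants
  map g := ModuleCat.ofHom (leftMap g (𝟙 N))
  map_id V := by
    ext : 1
    exact leftMap_id V N
  map_comp g g' := by
    ext : 1
    exact leftMap_comp rfl (by simp)

instance (N : Rep.{u + 1} k (Equiv.Perm (Fin d))) : (leftFunctor N).Additive where
  map_add {V W g g'} := by
    ext : 1
    exact leftMap_add g g' (𝟙 N)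

instance (N : Rep.{u + 1} k (Equiv.Perm (Fin d))) : (leftFunctor N).Linear k where
  map_smul {V W} g a := by
    ext : 1
    exact leftMap_smul a g (𝟙 N)

variable (k d) in
/-- The left adjoint `N ↦ (V ↦ V^{⊗ d} ⊗_{S_d} N)` of the Schur functor. -/
def left : Rep.{u + 1} k (Equiv.Perm (Fin d)) ⥤ SPF k d where
  obj N := of (leftFunctor N)
  map φ := ObjectProperty.homMk
    { app V := ModuleCat.ofHom (leftMap (𝟙 V) φ)
      naturality V W g := by
        ext : 1
        exact (leftMap_comp (g'' := g) (φ'' := φ) (by simp) (by simp)).symm.trans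
          (leftMap_comp (by simp) (by simp)) }
  map_id N := by
    ext V : 4
    exact leftMap_id V N
  map_comp φ φ' := by
    ext V : 4
    exact leftMap_comp (by simp) rfl

/-- The class of `v ⊗ n` in the value at `V` of the left adjoint. -/
def leftClass (N : Rep.{u + 1} k (Equiv.Perm (Fin d))) {V : DivPow k d} :
    V.pow →ₗ[k] N.V →ₗ[k] ((left k d).obj N).obj.obj V :=
  leftMk (N := N)

lemma leftClass_rho_left {N : Rep.{u + 1} k (Equiv.Perm (Fin d))} {V : DivPow k d}
    (σ : Equiv.Perm (Fin d)) (v : V.pow) (n : N.V) :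
    leftClass N (V.rho σ v) n = leftClass N v (N.ρ σ⁻¹ n) :=
  leftMk_rho_left (N := N) σ v n

lemma left_obj_map_leftClass (N : Rep.{u + 1} k (Equiv.Perm (Fin d))) {V W : DivPow k d}
    (g : V ⟶ W) (v : V.pow) (n : N.V) :
    ((left k d).obj N).obj.map g (leftClass N v n) = leftClass N (Hom.lin g v) n := rfl

/-- The unit `N ⟶ Hom(⊗^d, V ↦ V^{⊗ d} ⊗_{S_d} N)`. -/
def leftUnit (N : Rep.{u + 1} k (Equiv.Perm (Fin d))) : N ⟶ (schur k d).obj ((left k d).obj N) :=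
  Rep.ofHom ⟨{
    toFun n := homOfFamily (X := (left k d).obj N) (fun V => leftMk.flip n) fun g v => rfl
    map_add' n n' := hom_ext_ev fun V v => map_add (leftMk (N := N) v) n n'
    map_smul' a n := hom_ext_ev fun V v => map_smul (leftMk (N := N) v) a n }, fun σ => by
      refine LinearMap.ext fun n => hom_ext_ev (X := (left k d).obj N) fun V v => ?_
      have := leftMk_rho_left (N := N) σ⁻¹ v n
      rw [inv_inv] at this
      exact this.symm⟩

/-- The transpose of a map of representations `N ⟶ Hom(⊗^d, X)`. -/
def leftDesc {N : Rep.{u + 1} k (Equiv.Perm (Fin d))} {X : SPF k d} (φ : N ⟶ (schur k d).obj X) :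
    (left k d).obj N ⟶ X :=
  ObjectProperty.homMk
    { app V := ModuleCat.ofHom (leftLift ((evₗ X V ∘ₗ φ.hom.toLinearMap).flip) fun σ v n => by
        have h : φ.hom (N.ρ σ n) = schurRep X σ (φ.hom n) := Rep.hom_comm_apply φ σ n
        change ev (φ.hom (N.ρ σ n)) V (V.rho σ v) = ev (φ.hom n) V v
        refine (congrArg (fun f => ev (X := X) f V (V.rho σ v)) h).trans ?_
        exact congrArg (ev (X := X) (φ.hom n) V) (V.rho.inv_self_apply σ v))
      naturality V W g := by
        ext : 1
        exact left_ext (N := N) fun v n => ev_lin (X := X) (φ.hom n) g v }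

variable (k d) in
/-- `V ↦ V^{⊗ d} ⊗_{S_d} -` is left adjoint to the Schur functor. -/
def leftAdj : left k d ⊣ schur k d :=
  Adjunction.mkOfHomEquiv
    { homEquiv N X :=
        { toFun β := leftUnit N ≫ (schur k d).map β
          invFun := leftDesc
          left_inv β := by
            ext V : 4
            exact left_ext (N := N) fun v n => rfl
          right_inv φ := by
            ext n
            exact hom_ext_ev (X := X) fun V v => rfl }
      homEquiv_naturality_left_symm φ ψ := by
        ext V : 4
        exact left_ext (V := V) fun v n => rfl
      homEquiv_naturality_right β γ := by
        ext n
        rfl }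

/-- The contraction `v ⊗ n ↦ ∑ σ, ξ (σ⁻¹ v) • σ⁻¹ n` of the coinvariants of `V^{⊗ d} ⊗ N`. -/
def leftContract (N : Rep.{u + 1} k (Equiv.Perm (Fin d))) {V : DivPow k d}
    (ξ : Module.Dual k V.pow) : (powTensor k d V N).Coinvariants →ₗ[k] N.V :=
  leftLift (∑ σ : Equiv.Perm (Fin d), (LinearMap.lsmul k N.V).compl₁₂ (ξ ∘ₗ V.rho σ⁻¹) (N.ρ σ⁻¹))
    fun π v n => by
      simp only [LinearMap.sum_apply, LinearMap.compl₁₂_apply, LinearMap.comp_apply,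
        LinearMap.lsmul_apply]
      refine Fintype.sum_equiv (Equiv.mulLeft π⁻¹) _ _ fun σ => ?_
      simp only [Equiv.coe_mulLeft, mul_inv_rev, inv_inv, map_mul, Module.End.mul_apply]

lemma leftContract_leftMk (N : Rep.{u + 1} k (Equiv.Perm (Fin d))) {V : DivPow k d}
    (ξ : Module.Dual k V.pow) (v : V.pow) (n : N.V) :
    leftContract N ξ (leftMk v n) =
      ∑ σ : Equiv.Perm (Fin d), ξ (V.rho σ⁻¹ v) • N.ρ σ⁻¹ n := by
  simp [leftContract]

/-- In the coinvariants σ⁻¹ can be moved from n to w, which turns the sum defining the contraction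
into the one defining `trace ξ w`. -/
lemma leftMk_leftContract (N : Rep.{u + 1} k (Equiv.Perm (Fin d))) {V W : DivPow k d}
    (ξ : Module.Dual k V.pow) (w : W.pow) (y : (powTensor k d V N).Coinvariants) :
    leftMk (N := N) w (leftContract N ξ y) = leftMap (trace ξ w) (𝟙 N) y := by
  revert y
  refine LinearMap.congr_fun (f := leftMk (N := N) w ∘ₗ leftContract N ξ)
    (left_ext fun v n => ?_)
  rw [LinearMap.comp_apply, leftContract_leftMk, leftMap_leftMk, lin_trace]
  simp only [map_sum, map_smul, LinearMap.sum_apply, LinearMap.smul_apply, leftMk_rho_left]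
  rfl

/-- The inverse contracts f(t) against `genDual`. Contracting t ⊗ n leaves only the term n; in the
other direction, v ⊗ (contraction of f(t)) is the image of f(t) under `trace (genDual) v`, which is
f(v). -/
lemma bijective_leftUnit (N : Rep.{u + 1} k (Equiv.Perm (Fin d))) :
    Function.Bijective (leftUnit N).hom := by
  constructor
  · refine Function.LeftInverse.injective (g := fun f =>
      leftContract N (genDual k d) (ev (X := (left k d).obj N) f _ (genVec k d))) fun n => ?_
    refine (leftContract_leftMk N (genDual k d) (genVec k d) n).trans ?_
    rw [Finset.sum_eq_single 1]
    · simp only [genDual_rho_genVec]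
      simp
    · intro σ _ hσ
      rw [genDual_rho_genVec, if_neg (inv_ne_one.2 hσ), zero_smul]
    · simp
  · intro f
    refine ⟨leftContract N (genDual k d) (ev (X := (left k d).obj N) f _ (genVec k d)), ?_⟩
    refine hom_ext_ev (X := (left k d).obj N) fun V v => ?_
    refine (leftMk_leftContract N (genDual k d) v _).trans ?_
    exact congrArg (fun g => ev (X := (left k d).obj N) g V v)
      (coev_ev (X := (left k d).obj N) f)

/-- A bijective map of representations is an isomorphism. -/
lemma _root_.Rep.isIso_of_bijective {G : Type} [Group G] {M N : Rep.{u + 1} k G} (φ : M ⟶ N)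
    (h : Function.Bijective φ.hom) : IsIso φ :=
  (Rep.mkIso (Representation.Equiv.mk (LinearEquiv.ofBijective φ.hom.toLinearMap h)
    φ.hom.isIntertwining')).isIso_hom

instance isIso_leftAdj_unit : IsIso (leftAdj k d).unit := by
  rw [NatTrans.isIso_iff_isIso_app]
  intro N
  apply Rep.isIso_of_bijective
  exact bijective_leftUnit N

/-! ### The right adjoint -/

/-- The `k`-module of equivariant maps `(V^{⊗ d})^* → N`. -/
abbrev RightObj (V : DivPow k d) (N : Rep.{u + 1} k (Equiv.Perm (Fin d))) : Type (u + 1) :=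
  V.rho.dual.IntertwiningMap N.ρ

lemma right_hom_rho {V : DivPow k d} {N : Rep.{u + 1} k (Equiv.Perm (Fin d))} (β : RightObj V N)
    (ξ : Module.Dual k V.pow) (σ : Equiv.Perm (Fin d)) :
    β (ξ ∘ₗ V.rho σ⁻¹) = N.ρ σ (β ξ) :=
  LinearMap.congr_fun (β.isIntertwining' σ) ξ

/-- An equivariant map `(V^{⊗ d})^* → N`. -/
def rightMk {V : DivPow k d} {N : Rep.{u + 1} k (Equiv.Perm (Fin d))}
    (β : Module.Dual k V.pow →ₗ[k] N.V) (hβ : ∀ σ ξ, β (ξ ∘ₗ V.rho σ⁻¹) = N.ρ σ (β ξ)) :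
    RightObj V N :=
  ⟨β, fun σ => LinearMap.ext fun ξ => hβ σ ξ⟩

lemma right_ext {V : DivPow k d} {N : Rep.{u + 1} k (Equiv.Perm (Fin d))} {β β' : RightObj V N}
    (h : ∀ ξ, β ξ = β' ξ) : β = β' :=
  Representation.IntertwiningMap.ext (LinearMap.ext h)

/-- Functoriality of `Hom((V^{⊗ d})^*, N)`. -/
def rightMap {V V' : DivPow k d} {N N' : Rep.{u + 1} k (Equiv.Perm (Fin d))} (g : V ⟶ V')
    (φ : N ⟶ N') : RightObj V N →ₗ[k] RightObj V' N' where
  toFun β := rightMk (φ.hom.toLinearMap ∘ₗ β.toLinearMap ∘ₗ (Hom.lin g).dualMap) fun σ ξ => by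
    change φ.hom (β ((ξ ∘ₗ V'.rho σ⁻¹) ∘ₗ Hom.lin g)) = N'.ρ σ (φ.hom (β (ξ ∘ₗ Hom.lin g)))
    rw [LinearMap.comp_assoc, ← Hom.lin_comm, ← LinearMap.comp_assoc, right_hom_rho]
    exact Rep.hom_comm_apply φ σ _
  map_add' β β' := right_ext fun ξ => map_add φ.hom.toLinearMap _ _
  map_smul' a β := right_ext fun ξ => map_smul φ.hom.toLinearMap a _

/-- The functor `V ↦ Hom_{S_d}((V^{⊗ d})^*, N)`. -/
def rightFunctor (N : Rep.{u + 1} k (Equiv.Perm (Fin d))) : DivPow k d ⥤ ModuleCat.{u + 1} k where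
  obj V := ModuleCat.of k (RightObj V N)
  map g := ModuleCat.ofHom (rightMap g (𝟙 N))
  map_id _ := rfl
  map_comp _ _ := rfl

instance (N : Rep.{u + 1} k (Equiv.Perm (Fin d))) : (rightFunctor N).Additive where
  map_add {V W g g'} := by
    ext β : 2
    refine right_ext fun ξ => ?_
    change β.toLinearMap (ξ ∘ₗ (Hom.lin g + Hom.lin g')) =
      β.toLinearMap (ξ ∘ₗ Hom.lin g) + β.toLinearMap (ξ ∘ₗ Hom.lin g')
    rw [LinearMap.comp_add, map_add]

instance (N : Rep.{u + 1} k (Equiv.Perm (Fin d))) : (rightFunctor N).Linear k where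
  map_smul {V W} g a := by
    ext β : 2
    refine right_ext fun ξ => ?_
    change β.toLinearMap (ξ ∘ₗ (a • Hom.lin g)) = a • β.toLinearMap (ξ ∘ₗ Hom.lin g)
    rw [LinearMap.comp_smul, map_smul]

variable (k d) in
/-- The right adjoint `N ↦ (V ↦ Hom_{S_d}((V^{⊗ d})^*, N))` of the Schur functor. -/
def right : Rep.{u + 1} k (Equiv.Perm (Fin d)) ⥤ SPF k d where
  obj N := of (rightFunctor N)
  map φ := ObjectProperty.homMk
    { app V := ModuleCat.ofHom (rightMap (𝟙 V) φ)
      naturality _ _ _ := rfl }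
  map_id _ := rfl
  map_comp _ _ := rfl

/-- The map `(V^{⊗ d})^* → N` underlying an element of the right adjoint at `V`. -/
def rightVal {N : Rep.{u + 1} k (Equiv.Perm (Fin d))} {V : DivPow k d} :
    ((right k d).obj N).obj.obj V →ₗ[k] Module.Dual k V.pow →ₗ[k] N.V where
  toFun b := Representation.IntertwiningMap.toLinearMap (show RightObj V N from b)
  map_add' _ _ := rfl
  map_smul' _ _ := rfl

lemma rightVal_ext {N : Rep.{u + 1} k (Equiv.Perm (Fin d))} {V : DivPow k d}
    {b b' : ((right k d).obj N).obj.obj V} (h : ∀ ξ, rightVal b ξ = rightVal b' ξ) : b = b' :=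
  right_ext (N := N) h

lemma rightVal_rho {N : Rep.{u + 1} k (Equiv.Perm (Fin d))} {V : DivPow k d}
    (b : ((right k d).obj N).obj.obj V) (ξ : Module.Dual k V.pow) (σ : Equiv.Perm (Fin d)) :
    rightVal b (ξ ∘ₗ V.rho σ⁻¹) = N.ρ σ (rightVal b ξ) :=
  right_hom_rho (N := N) b ξ σ

/-- The transpose of a map of representations `Hom(⊗^d, X) ⟶ N`. -/
def rightLift {N : Rep.{u + 1} k (Equiv.Perm (Fin d))} {X : SPF k d} (φ : (schur k d).obj X ⟶ N) :
    X ⟶ (right k d).obj N :=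
  ObjectProperty.homMk
    { app V := ModuleCat.ofHom
        { toFun x := rightMk (N := N) (φ.hom.toLinearMap ∘ₗ coevₗ X V x) fun σ ξ =>
            (congrArg φ.hom (schurRep_coev x ξ σ).symm).trans (Rep.hom_comm_apply φ σ (coev x ξ))
          map_add' x y := right_ext (N := N) fun ξ => by
            change φ.hom.toLinearMap (coevₗ X V (x + y) ξ) =
              φ.hom.toLinearMap (coevₗ X V x ξ) + φ.hom.toLinearMap (coevₗ X V y ξ)
            rw [map_add]
            exact map_add φ.hom.toLinearMap _ _
          map_smul' a x := right_ext (N := N) fun ξ => by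
            change φ.hom.toLinearMap (coevₗ X V (a • x) ξ) =
              a • φ.hom.toLinearMap (coevₗ X V x ξ)
            rw [map_smul]
            exact map_smul φ.hom.toLinearMap a _ }
      naturality V W g := by
        ext x : 2
        exact right_ext (N := N) fun ξ => congrArg φ.hom (coev_map x g ξ) }

/-- The linear map `Hom(⊗^d, X) → N` underlying the transpose of `X ⟶ right N`. -/
def rightEval {N : Rep.{u + 1} k (Equiv.Perm (Fin d))} {X : SPF k d}
    (β : X ⟶ (right k d).obj N) : (tensorPower k d ⟶ X) →ₗ[k] N.V where
  toFun f := rightVal (β.hom.app _ (ev f (gen k d) (genVec k d))) (genDual k d)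
  map_add' f f' := by
    rw [ev_add, map_add, map_add]
    rfl
  map_smul' a f := by
    rw [ev_smul, map_smul, map_smul]
    rfl

/-- Naturality of β along `trace ξ t` : V ⟶ k^d, with t the generator, pulls `genDual` back to ξ.
Since every transformation is a `coev`, this determines `rightEval`. -/
lemma rightEval_coev {N : Rep.{u + 1} k (Equiv.Perm (Fin d))} {X : SPF k d}
    (β : X ⟶ (right k d).obj N) {V : DivPow k d} (x : X.obj.obj V) (ξ : Module.Dual k V.pow) :
    rightEval β (coev x ξ) = rightVal (β.hom.app V x) ξ := by
  have h := ConcreteCategory.congr_hom (β.hom.naturality (trace ξ (genVec k d))) x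
  refine (congrArg (fun b => rightVal b (genDual k d)) h).trans ?_
  exact congrArg (rightVal (β.hom.app V x)) (genDual_trace ξ)

/-- The transpose of a map `X ⟶ right N`. -/
def rightDesc {N : Rep.{u + 1} k (Equiv.Perm (Fin d))} {X : SPF k d}
    (β : X ⟶ (right k d).obj N) : (schur k d).obj X ⟶ N :=
  Rep.ofHom ⟨rightEval β, fun σ => LinearMap.ext fun f => by
    change rightEval β (schurRep X σ f) = N.ρ σ (rightEval β f)
    -- Equivariance only has to be tested on `coev x ξ`, where S_d acts through ξ and the values of
    -- β are equivariant.
    rw [← coev_ev f, schurRep_coev, rightEval_coev, rightEval_coev, rightVal_rho]⟩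

variable (k d) in
/-- `V ↦ Hom_{S_d}((V^{⊗ d})^*, -)` is right adjoint to the Schur functor. -/
def rightAdj : schur k d ⊣ right k d :=
  Adjunction.mkOfHomEquiv
    { homEquiv X N :=
        { toFun := rightLift
          invFun := rightDesc
          left_inv φ := by
            ext f
            change φ.hom (coev (X := X) _ _) = φ.hom f
            exact congrArg φ.hom (coev_ev (X := X) f)
          right_inv β := by
            ext V x : 5
            exact rightVal_ext fun ξ => rightEval_coev β x ξ }
      homEquiv_naturality_left_symm α β := by
        ext f
        rfl
      homEquiv_naturality_right φ ψ := by
        ext V x : 5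
        rfl }

end SPF

/-! ### Linear maps out of Hom(A, M) for A finitely generated projective. -/

section RankOne

variable {k : Type u} [CommRing k] {A : Type u} [AddCommGroup A] [Module k A] [Module.Finite k A]
  [Module.Projective k A] {M : Type u} [AddCommGroup M] [Module k M]
  {P : Type*} [AddCommGroup P] [Module k P]

/-- Linear maps out of `Hom(A, M)` are given by their values on rank one maps. -/
def rankOneLift (b : Module.Dual k A →ₗ[k] M →ₗ[k] P) : (A →ₗ[k] M) →ₗ[k] P :=
  TensorProduct.lift b ∘ₗ (dualTensorHomEquiv k A M).symm.toLinearMap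

lemma rankOneLift_smulRight (b : Module.Dual k A →ₗ[k] M →ₗ[k] P) (ξ : Module.Dual k A) (m : M) :
    rankOneLift b (ξ.smulRight m) = b ξ m := by
  have h : ξ.smulRight m = dualTensorHomEquiv k A M (ξ ⊗ₜ m) := by
    ext a
    simp
  rw [h, rankOneLift, LinearMap.comp_apply, LinearEquiv.coe_coe, LinearEquiv.symm_apply_apply,
    TensorProduct.lift.tmul]

lemma rankOne_ext {f g : (A →ₗ[k] M) →ₗ[k] P}
    (h : ∀ (ξ : Module.Dual k A) (m : M), f (ξ.smulRight m) = g (ξ.smulRight m)) : f = g := by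
  have : f ∘ₗ (dualTensorHomEquiv k A M).toLinearMap =
      g ∘ₗ (dualTensorHomEquiv k A M).toLinearMap := by
    refine TensorProduct.ext' fun ξ m => ?_
    have h' : ξ.smulRight m = dualTensorHomEquiv k A M (ξ ⊗ₜ m) := by
      ext a
      simp
    rw [LinearMap.comp_apply, LinearMap.comp_apply, LinearEquiv.coe_coe, ← h', h]
  refine LinearMap.ext fun φ => ?_
  obtain ⟨z, rfl⟩ := (dualTensorHomEquiv k A M).surjective φ
  exact LinearMap.congr_fun this z

end RankOne

/-- Precomposition of a trilinear map in the last two variables. -/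
def _root_.LinearMap.compl₂₃ {k A B B' C C' D : Type*} [CommRing k] [AddCommGroup A] [Module k A]
    [AddCommGroup B] [Module k B] [AddCommGroup B'] [Module k B'] [AddCommGroup C] [Module k C]
    [AddCommGroup C'] [Module k C'] [AddCommGroup D] [Module k D]
    (f : A →ₗ[k] B →ₗ[k] C →ₗ[k] D) (p : B' →ₗ[k] B) (q : C' →ₗ[k] C) :
    A →ₗ[k] B' →ₗ[k] C' →ₗ[k] D where
  toFun a := (f a).compl₁₂ p q
  map_add' a b := by rw [map_add]; rfl
  map_smul' a b := by rw [map_smul]; rfl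

namespace SPF

open DivPow

variable {k : Type u} [CommRing k] {d : ℕ}

/-- An isomorphism of strict polynomial functors from a natural family of linear equivalences. -/
def isoOfFamily {X Y : SPF k d} (e : ∀ V, X.obj.obj V ≃ₗ[k] Y.obj.obj V)
    (h : ∀ {V W : DivPow k d} (g : V ⟶ W) (x : X.obj.obj V),
      e W (X.obj.map g x) = Y.obj.map g (e V x)) : X ≅ Y :=
  ObjectProperty.isoMk _ (NatIso.ofComponents (fun V => (e V).toModuleIso) fun {V W} g => by
    ext x
    exact h g x)

/-! ### The left adjoint and the internal tensor product -/

open scoped Classical in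
/-- The class of `h ⊗ x ⊗ y` in the Day convolution as a trilinear map. -/
def dayMkₗ (X Y : SPF k d) (U V W : DivPow k d) :
    (tensor V W ⟶ U) →ₗ[k] X.obj.obj V →ₗ[k] Y.obj.obj W →ₗ[k] Day X Y U :=
  TensorProduct.lcurry (.id k) _ _ _ ∘ₗ TensorProduct.curry
    ((dayRel X Y U).mkQ ∘ₗ DirectSum.lof k _ (DayTerm X Y U) (V, W))

lemma dayMk_tensorMap {X Y : SPF k d} {U V V' W W' : DivPow k d} (a : V ⟶ V') (b : W ⟶ W')
    (h : tensor V' W' ⟶ U) (x : X.obj.obj V) (y : Y.obj.obj W) :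
    dayMk X Y (tensorMap a b ≫ h) x y = dayMk X Y h (X.obj.map a x) (Y.obj.map b y) := by
  rw [← sub_eq_zero, dayMk, dayMk, ← map_sub, Submodule.mkQ_apply, Submodule.Quotient.mk_eq_zero]
  exact Submodule.subset_span ⟨V, V', W, W', a, b, h, x, y, rfl⟩

open scoped Classical in
/-- Linear maps out of the Day convolution. -/
def dayDesc {X Y : SPF k d} {U : DivPow k d} {M : Type (u + 1)} [AddCommGroup M] [Module k M]
    (φ : ∀ V W : DivPow k d, (tensor V W ⟶ U) →ₗ[k] X.obj.obj V →ₗ[k] Y.obj.obj W →ₗ[k] M)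
    (hφ : ∀ {V V' W W' : DivPow k d} (a : V ⟶ V') (b : W ⟶ W') (h : tensor V' W' ⟶ U)
      (x : X.obj.obj V) (y : Y.obj.obj W),
      φ V W (tensorMap a b ≫ h) x y = φ V' W' h (X.obj.map a x) (Y.obj.map b y)) :
    Day X Y U →ₗ[k] M :=
  (dayRel X Y U).liftQ (DirectSum.toModule k _ M fun p =>
    TensorProduct.lift (TensorProduct.uncurry (.id k) _ _ _ ∘ₗ φ p.1 p.2)) (by
      rw [dayRel, Submodule.span_le]
      rintro _ ⟨V, V', W, W', a, b, h, x, y, rfl⟩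
      rw [SetLike.mem_coe, LinearMap.mem_ker, map_sub, sub_eq_zero, dayPre, dayPre,
        DirectSum.toModule_lof, DirectSum.toModule_lof]
      exact hφ a b h x y)

lemma dayDesc_dayMk {X Y : SPF k d} {U : DivPow k d} {M : Type (u + 1)} [AddCommGroup M]
    [Module k M]
    (φ : ∀ V W : DivPow k d, (tensor V W ⟶ U) →ₗ[k] X.obj.obj V →ₗ[k] Y.obj.obj W →ₗ[k] M)
    (hφ) {V W : DivPow k d} (h : tensor V W ⟶ U) (x : X.obj.obj V) (y : Y.obj.obj W) :
    dayDesc (X := X) (Y := Y) φ hφ (dayMk X Y h x y) = φ V W h x y := by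
  classical
  rw [dayDesc, dayMk, Submodule.mkQ_apply, Submodule.liftQ_apply, dayPre]
  rw [DirectSum.toModule_lof]
  rfl

/-- The diagonal representation `Hom(⊗^d, X) ⊗ N`. -/
abbrev schurTensor (X : SPF k d) (N : Rep.{u + 1} k (Equiv.Perm (Fin d))) :
    Rep.{u + 1} k (Equiv.Perm (Fin d)) :=
  ((kronecker k (Equiv.Perm (Fin d))).obj ((schur k d).obj X)).obj N

/-- The pure tensor `f ⊗ n` in `Hom(⊗^d, X) ⊗ N`. -/
def schurMk (X : SPF k d) (N : Rep.{u + 1} k (Equiv.Perm (Fin d))) :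
    (tensorPower k d ⟶ X) →ₗ[k] N.V →ₗ[k] (schurTensor X N).V :=
  TensorProduct.mk k (tensorPower k d ⟶ X) N.V

lemma schurMk_rho (X : SPF k d) (N : Rep.{u + 1} k (Equiv.Perm (Fin d)))
    (σ : Equiv.Perm (Fin d)) (f : tensorPower k d ⟶ X) (n : N.V) :
    schurMk X N (schurRep X σ f) (N.ρ σ n) = (schurTensor X N).ρ σ (schurMk X N f n) := rfl

lemma schurTensor_ext {X : SPF k d} {N : Rep.{u + 1} k (Equiv.Perm (Fin d))} {U : DivPow k d}
    {M : Type*} [AddCommGroup M] [Module k M]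
    {f g : (powTensor k d U (schurTensor X N)).Coinvariants →ₗ[k] M}
    (h : ∀ u φ n, f (leftMk u (schurMk X N φ n)) = g (leftMk u (schurMk X N φ n))) : f = g :=
  left_ext fun u z => LinearMap.congr_fun
    (f := f ∘ₗ leftMk (N := schurTensor X N) u) (g := g ∘ₗ leftMk (N := schurTensor X N) u)
    (TensorProduct.ext' (M := (tensorPower k d ⟶ X)) fun φ n => h u φ n) z

/-- The bilinear map `(f, n) ↦ [trace ⊗ f(t) ⊗ (t ⊗ n)]` into the Day convolution, where `t` is
the generator `e_1 ⊗ ⋯ ⊗ e_d`. -/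
def toDayAux (X : SPF k d) (N : Rep.{u + 1} k (Equiv.Perm (Fin d))) (U : DivPow k d) :
    U.pow →ₗ[k] (tensorPower k d ⟶ X) →ₗ[k] N.V →ₗ[k] Day X ((left k d).obj N) U :=
  LinearMap.compl₂₃ (dayMkₗ X ((left k d).obj N) U (gen k d) (gen k d) ∘ₗ
      traceₗ _ U (dualTensor (genDual k d) (genDual k d)))
    ((evₗ X (gen k d)).flip (genVec k d)) (leftClass N (genVec k d))

lemma toDayAux_apply (X : SPF k d) (N : Rep.{u + 1} k (Equiv.Perm (Fin d))) (U : DivPow k d)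
    (u : U.pow) (f : tensorPower k d ⟶ X) (n : N.V) :
    toDayAux X N U u f n = dayMk X ((left k d).obj N)
      (trace (dualTensor (genDual k d) (genDual k d)) u) (ev f _ (genVec k d))
      (leftClass N (genVec k d) n) := rfl

lemma genDual_trace_rho {V : DivPow k d} (ξ : Module.Dual k V.pow) (σ : Equiv.Perm (Fin d)) :
    genDual k d ∘ₗ Hom.lin (trace ξ ((gen k d).rho σ (genVec k d))) = ξ ∘ₗ V.rho σ := by
  rw [← trace_rho, genDual_trace]

/-- The action of σ on f and on n amounts to replacing t by σ⁻¹t in f(t) and in t ⊗ n. Both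
replacements come from the same endomorphism of k^d, so the coend relation moves them into the Hom
factor, where they cancel the σ on u. -/
lemma toDayAux_rho (X : SPF k d) (N : Rep.{u + 1} k (Equiv.Perm (Fin d))) (U : DivPow k d)
    (σ : Equiv.Perm (Fin d)) (u : U.pow) (f : tensorPower k d ⟶ X) (n : N.V) :
    toDayAux X N U (U.rho σ u) (schurRep X σ f) (N.ρ σ n) = toDayAux X N U u f n := by
  have hy : leftClass N (genVec k d) (N.ρ σ n) =
      ((left k d).obj N).obj.map (trace (genDual k d) ((gen k d).rho σ⁻¹ (genVec k d)))
        (leftClass N (genVec k d) n) := by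
    rw [left_obj_map_leftClass, trace_genVec, leftClass_rho_left, inv_inv]
  have hx : ev (schurRep X σ f) (gen k d) (genVec k d) =
      X.obj.map (trace (genDual k d) ((gen k d).rho σ⁻¹ (genVec k d)))
        (ev f (gen k d) (genVec k d)) := by
    rw [← ev_lin, trace_genVec, ev_schurRep]
  rw [toDayAux_apply, toDayAux_apply, hx, hy, ← dayMk_tensorMap, comp_trace, dualTensor_comp_tensorMap, genDual_trace_rho,
    ← dualTensor_comp_rho, trace_rho]
  congr 2
  exact U.rho.inv_self_apply σ u

/-- The comparison map `U^{⊗ d} ⊗_{S_d} (Sch X ⊗ N) → (X ⊗ left N)(U)`. -/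
def toDay (X : SPF k d) (N : Rep.{u + 1} k (Equiv.Perm (Fin d))) (U : DivPow k d) :
    (powTensor k d U (schurTensor X N)).Coinvariants →ₗ[k] Day X ((left k d).obj N) U :=
  leftLift (N := schurTensor X N)
    (TensorProduct.uncurry (.id k) _ _ _ ∘ₗ toDayAux X N U) fun σ u z => by
      revert z
      refine LinearMap.congr_fun
        (f := TensorProduct.lift (toDayAux X N U (U.rho σ u)) ∘ₗ (schurTensor X N).ρ σ)
        (g := TensorProduct.lift (toDayAux X N U u)) ?_
      exact TensorProduct.ext' fun f n => toDayAux_rho X N U σ u f n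

lemma toDay_leftMk (X : SPF k d) (N : Rep.{u + 1} k (Equiv.Perm (Fin d))) (U : DivPow k d)
    (u : U.pow) (f : tensorPower k d ⟶ X) (n : N.V) :
    toDay X N U (leftMk u (schurMk X N f n)) =
      dayMk X ((left k d).obj N) (trace (dualTensor (genDual k d) (genDual k d)) u)
        (ev f _ (genVec k d)) (leftClass N (genVec k d) n) := rfl

/-- The trilinear map sending the rank one map `v ↦ ξ v • u` and `x`, `n` to the class of
`u ⊗ coev x ξ ⊗ n`. -/
def contract (X : SPF k d) (N : Rep.{u + 1} k (Equiv.Perm (Fin d))) (U V : DivPow k d) :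
    (V.pow →ₗ[k] U.pow) →ₗ[k] X.obj.obj V →ₗ[k] N.V →ₗ[k]
      (powTensor k d U (schurTensor X N)).Coinvariants :=
  rankOneLift (LinearMap.mk₂ k
    (fun ξ u => (schurMk X N).compr₂ (leftMk u) ∘ₗ (coevₗ X V).flip ξ)
    (fun ξ ξ' u => by ext x n; simp) (fun a ξ u => by ext x n; simp)
    (fun ξ u u' => by ext x n; simp) (fun a ξ u => by ext x n; simp))

lemma contract_smulRight (X : SPF k d) (N : Rep.{u + 1} k (Equiv.Perm (Fin d))) (U V : DivPow k d)
    (ξ : Module.Dual k V.pow) (u : U.pow) (x : X.obj.obj V) (n : N.V) :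
    contract X N U V (ξ.smulRight u) x n = leftMk u (schurMk X N (coev x ξ) n) := by
  rw [contract, rankOneLift_smulRight]
  rfl

/-- This is the part of the coend relation concerning V; on rank one maps it is dinaturality of
`coev`. -/
lemma contract_comp_lin {X : SPF k d} {N : Rep.{u + 1} k (Equiv.Perm (Fin d))}
    {U V V' : DivPow k d} (a : V ⟶ V') (φ : V'.pow →ₗ[k] U.pow) (x : X.obj.obj V) (n : N.V) :
    contract X N U V (φ ∘ₗ Hom.lin a) x n = contract X N U V' φ (X.obj.map a x) n := by
  revert φ
  refine LinearMap.congr_fun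
    (f := ((contract X N U V).flip x).flip n ∘ₗ LinearMap.lcomp k U.pow (Hom.lin a))
    (g := ((contract X N U V').flip (X.obj.map a x)).flip n) (rankOne_ext fun ξ u => ?_)
  change contract X N U V ((ξ ∘ₗ Hom.lin a).smulRight u) x n =
    contract X N U V' (ξ.smulRight u) (X.obj.map a x) n
  rw [contract_smulRight, contract_smulRight, coev_map]

/-- Conjugating ξ(-) u moves both ξ and u by σ, so together with σ on n the whole tensor is
translated by σ, which is invisible in the coinvariants. Combined with `slice_rho` it makes
`ofDayAux` well defined on classes of w ⊗ n. -/
lemma contract_rho {X : SPF k d} {N : Rep.{u + 1} k (Equiv.Perm (Fin d))}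
    {U V : DivPow k d} (σ : Equiv.Perm (Fin d)) (φ : V.pow →ₗ[k] U.pow) (x : X.obj.obj V)
    (n : N.V) :
    contract X N U V (U.rho σ ∘ₗ φ ∘ₗ V.rho σ⁻¹) x (N.ρ σ n) = contract X N U V φ x n := by
  revert φ
  refine LinearMap.congr_fun
    (f := ((contract X N U V).flip x).flip (N.ρ σ n) ∘ₗ LinearMap.lcomp k U.pow (V.rho σ⁻¹) ∘ₗ
      LinearMap.llcomp k V.pow U.pow U.pow (U.rho σ))
    (g := ((contract X N U V).flip x).flip n) (rankOne_ext fun ξ u => ?_)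
  have h : U.rho σ ∘ₗ ξ.smulRight u ∘ₗ V.rho σ⁻¹ =
      (ξ ∘ₗ V.rho σ⁻¹).smulRight (U.rho σ u) := by
    refine LinearMap.ext fun v => ?_
    simp
  change contract X N U V (U.rho σ ∘ₗ ξ.smulRight u ∘ₗ V.rho σ⁻¹) x (N.ρ σ n) =
    contract X N U V (ξ.smulRight u) x n
  rw [h, contract_smulRight, contract_smulRight, ← schurRep_coev, schurMk_rho, leftMk_rho]

/-- The maps `v ↦ h(v ⊗ w)`. -/
def slice (U V W : DivPow k d) : (tensor V W ⟶ U) →ₗ[k] W.pow →ₗ[k] V.pow →ₗ[k] U.pow where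
  toFun h := (TensorProduct.curry
    (Hom.lin h ∘ₗ (zipEquiv k d V.carrier W.carrier).toLinearMap)).flip
  map_add' _ _ := rfl
  map_smul' _ _ := rfl

lemma slice_apply {U V W : DivPow k d} (h : tensor V W ⟶ U) (w : W.pow) (v : V.pow) :
    slice U V W h w v = Hom.lin h (zipEquiv k d V.carrier W.carrier (v ⊗ₜ w)) := rfl

lemma slice_rho {U V W : DivPow k d} (h : tensor V W ⟶ U) (w : W.pow) (σ : Equiv.Perm (Fin d)) :
    slice U V W h (W.rho σ w) = U.rho σ ∘ₗ slice U V W h w ∘ₗ V.rho σ⁻¹ :=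
  LinearMap.ext fun v => by
    rw [LinearMap.comp_apply, LinearMap.comp_apply, slice_apply, slice_apply, ← lin_rho,
      rho_zipEquiv]
    congr 3
    exact (V.rho.self_inv_apply σ v).symm

lemma slice_tensorMap {U V V' W W' : DivPow k d} (a : V ⟶ V') (b : W ⟶ W') (h : tensor V' W' ⟶ U)
    (w : W.pow) :
    slice U V W (tensorMap a b ≫ h) w = slice U V' W' h (Hom.lin b w) ∘ₗ Hom.lin a :=
  LinearMap.ext fun v => by
    rw [LinearMap.comp_apply, slice_apply, slice_apply, lin_comp, LinearMap.comp_apply,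
      lin_tensorMap_zipEquiv]

/-- The contribution of the summand of index `(V, W)` to the inverse of `toDay`. -/
def ofDayAux (X : SPF k d) (N : Rep.{u + 1} k (Equiv.Perm (Fin d))) (U V W : DivPow k d) :
    (tensor V W ⟶ U) →ₗ[k] X.obj.obj V →ₗ[k] ((left k d).obj N).obj.obj W →ₗ[k]
      (powTensor k d U (schurTensor X N)).Coinvariants :=
  LinearMap.mk₂ k (fun h x =>
    leftLift (N := N) ((contract X N U V).flip x ∘ₗ slice U V W h) fun σ w n => by
      change contract X N U V (slice U V W h (W.rho σ w)) x (N.ρ σ n) = _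
      rw [slice_rho, contract_rho]
      rfl)
    (fun h h' x => left_ext (N := N) fun w n => by simp; rfl)
    (fun a h x => left_ext (N := N) fun w n => by simp; rfl)
    (fun h x x' => left_ext (N := N) fun w n => by simp; rfl)
    (fun a h x => left_ext (N := N) fun w n => by simp; rfl)

/-- The inverse of `toDay`. -/
def ofDay (X : SPF k d) (N : Rep.{u + 1} k (Equiv.Perm (Fin d))) (U : DivPow k d) :
    Day X ((left k d).obj N) U →ₗ[k] (powTensor k d U (schurTensor X N)).Coinvariants :=
  dayDesc (ofDayAux X N U) fun {V V' W W'} a b h x y => by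
    revert y
    refine LinearMap.congr_fun (f := ofDayAux X N U V W (tensorMap a b ≫ h) x)
      (g := ofDayAux X N U V' W' h (X.obj.map a x) ∘ₗ leftMap b (𝟙 N)) ?_
    refine left_ext (N := N) fun w n => ?_
    change contract X N U V (slice U V W (tensorMap a b ≫ h) w) x n =
      contract X N U V' (slice U V' W' h (Hom.lin b w)) (X.obj.map a x) n
    rw [slice_tensorMap, contract_comp_lin]

lemma ofDay_dayMk (X : SPF k d) (N : Rep.{u + 1} k (Equiv.Perm (Fin d))) {U V W : DivPow k d}
    (h : tensor V W ⟶ U) (x : X.obj.obj V) (w : W.pow) (n : N.V) :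
    ofDay X N U (dayMk X ((left k d).obj N) h x (leftClass N w n)) =
      contract X N U V (slice U V W h w) x n :=
  dayDesc_dayMk _ _ _ _ _

/-- Evaluating the second factor at the generator kills every term of the trace but σ = 1. It says
that `ofDay` undoes `toDay`, up to `coev_ev`. -/
lemma slice_trace_genVec (U : DivPow k d) (u : U.pow) :
    slice U (gen k d) (gen k d) (trace (dualTensor (genDual k d) (genDual k d)) u) (genVec k d) =
      (genDual k d).smulRight u :=
  LinearMap.ext fun v => by
    rw [slice_apply, lin_trace, Finset.sum_eq_single 1]
    · rw [inv_one, map_one, map_one, Module.End.one_apply, Module.End.one_apply,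
        dualTensor_zipEquiv]
      have := genDual_rho_genVec (k := k) (d := d) 1
      rw [map_one, Module.End.one_apply, if_pos rfl] at this
      rw [this, mul_one, LinearMap.smulRight_apply]
    · intro σ _ hσ
      rw [rho_zipEquiv, dualTensor_zipEquiv, genDual_rho_genVec, if_neg (inv_ne_one.2 hσ),
        mul_zero, zero_smul]
    · simp

lemma ofDay_toDay (X : SPF k d) (N : Rep.{u + 1} k (Equiv.Perm (Fin d))) (U : DivPow k d) :
    ofDay X N U ∘ₗ toDay X N U = LinearMap.id :=
  schurTensor_ext fun u f n => by
    rw [LinearMap.comp_apply, toDay_leftMk, ofDay_dayMk, slice_trace_genVec, contract_smulRight,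
      coev_ev]
    rfl

/-- The morphism `V ⊗ k^d ⟶ U` given by
`v ⊗ s ↦ ∑ σ, genDual (σ⁻¹ s) • σ (φ (σ⁻¹ v))`. -/
def spread (U V : DivPow k d) : (V.pow →ₗ[k] U.pow) →ₗ[k] (tensor V (gen k d) ⟶ U) :=
  rankOneLift (traceₗ (tensor V (gen k d)) U ∘ₗ (dualTensorₗ V (gen k d)).flip (genDual k d))

lemma spread_smulRight (U V : DivPow k d) (ξ : Module.Dual k V.pow) (u : U.pow) :
    spread U V (ξ.smulRight u) = trace (dualTensor ξ (genDual k d)) u := by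
  rw [spread, rankOneLift_smulRight]
  rfl

lemma lin_spread {U V : DivPow k d} (φ : V.pow →ₗ[k] U.pow) (v : V.pow) (s : (gen k d).pow) :
    Hom.lin (spread U V φ) (zipEquiv k d V.carrier (gen k d).carrier (v ⊗ₜ s)) =
      ∑ σ : Equiv.Perm (Fin d),
        genDual k d ((gen k d).rho σ⁻¹ s) • U.rho σ (φ (V.rho σ⁻¹ v)) := by
  have h : (linₗ (tensor V (gen k d)) U ∘ₗ spread U V).flip
        (zipEquiv k d V.carrier (gen k d).carrier (v ⊗ₜ s)) =
      ∑ σ : Equiv.Perm (Fin d), genDual k d ((gen k d).rho σ⁻¹ s) •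
        (U.rho σ ∘ₗ LinearMap.applyₗ (V.rho σ⁻¹ v)) := by
    refine rankOne_ext fun ξ u => ?_
    change Hom.lin (spread U V (ξ.smulRight u)) _ = _
    rw [spread_smulRight, lin_trace, LinearMap.sum_apply]
    refine Finset.sum_congr rfl fun σ _ => ?_
    rw [rho_zipEquiv, dualTensor_zipEquiv, mul_comm, mul_smul]
    simp
  refine (LinearMap.congr_fun h φ).trans ?_
  rw [LinearMap.sum_apply]
  rfl

/-- Equivariance of h turns σ h(σ⁻¹v ⊗ w) into h(v ⊗ σw), so the sum becomes h applied to v ⊗ ∑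
`genDual`(σ⁻¹s) σw. -/
lemma spread_slice {U V W : DivPow k d} (h : tensor V W ⟶ U) (w : W.pow) :
    spread U V (slice U V W h w) = tensorMap (𝟙 V) (trace (genDual k d) w) ≫ h := by
  refine hom_ext (ext_zipEquiv_tmul fun v s => ?_)
  rw [lin_spread, lin_comp, LinearMap.comp_apply, lin_tensorMap_zipEquiv, lin_trace, lin_id,
    LinearMap.id_apply, ← slice_apply]
  have key (σ : Equiv.Perm (Fin d)) :
      U.rho σ (slice U V W h w (V.rho σ⁻¹ v)) = slice U V W h (W.rho σ w) v := by
    rw [slice_rho]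
    rfl
  simp [key]

/-- On a rank one map, the coend relation absorbs the morphism `trace ξ t` acting on x and replaces
`genDual` by ξ in the first factor. -/
lemma toDay_contract {X : SPF k d} {N : Rep.{u + 1} k (Equiv.Perm (Fin d))} {U V : DivPow k d}
    (φ : V.pow →ₗ[k] U.pow) (x : X.obj.obj V) (n : N.V) :
    toDay X N U (contract X N U V φ x n) =
      dayMk X ((left k d).obj N) (spread U V φ) x (leftClass N (genVec k d) n) := by
  revert φ
  refine LinearMap.congr_fun
    (f := toDay X N U ∘ₗ ((contract X N U V).flip x).flip n)
    (g := ((dayMkₗ X ((left k d).obj N) U V (gen k d)).flip x).flip (leftClass N (genVec k d) n) ∘ₗ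
      spread U V) (rankOne_ext fun ξ u => ?_)
  change toDay X N U (contract X N U V (ξ.smulRight u) x n) =
    dayMk X ((left k d).obj N) (spread U V (ξ.smulRight u)) x (leftClass N (genVec k d) n)
  -- The coend relation acts on both variables at once; the second one is given the identity
  -- morphism.
  have hy : leftClass N (genVec k d) n =
      ((left k d).obj N).obj.map (𝟙 _) (leftClass N (genVec k d) n) := by
    rw [left_obj_map_leftClass, lin_id, LinearMap.id_apply]
  rw [contract_smulRight, toDay_leftMk, ev_coev, spread_smulRight]
  refine (congrArg (dayMk X ((left k d).obj N) _ _) hy).trans ?_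
  rw [← dayMk_tensorMap, comp_trace, dualTensor_comp_tensorMap, genDual_trace, lin_id,
    LinearMap.comp_id]

lemma toDay_ofDay (X : SPF k d) (N : Rep.{u + 1} k (Equiv.Perm (Fin d))) (U : DivPow k d) :
    toDay X N U ∘ₗ ofDay X N U = LinearMap.id :=
  day_ext fun V W h x y => by
    revert y
    refine LinearMap.congr_fun (f := toDay X N U ∘ₗ ofDay X N U ∘ₗ dayMkₗ X _ U V W h x)
      (g := dayMkₗ X ((left k d).obj N) U V W h x) (left_ext (N := N) fun w n => ?_)
    change toDay X N U (ofDay X N U (dayMk X ((left k d).obj N) h x (leftClass N w n))) =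
      dayMk X ((left k d).obj N) h x (leftClass N w n)
    -- After `spread_slice` the coend relation carries `trace (genDual) w` to the class of t ⊗ n, t
    -- the generator, and turns it into w ⊗ n.
    rw [ofDay_dayMk, toDay_contract, spread_slice, dayMk_tensorMap,
      CategoryTheory.Functor.map_id, left_obj_map_leftClass, trace_genVec]
    rfl

/-- The comparison isomorphism `U^{⊗ d} ⊗_{S_d} (Sch X ⊗ N) ≃ (X ⊗ left N)(U)`. -/
def dayEquiv (X : SPF k d) (N : Rep.{u + 1} k (Equiv.Perm (Fin d))) (U : DivPow k d) :
    (powTensor k d U (schurTensor X N)).Coinvariants ≃ₗ[k] Day X ((left k d).obj N) U :=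
  LinearEquiv.ofLinearMap (toDay X N U) (ofDay X N U) (toDay_ofDay X N U) (ofDay_toDay X N U)

variable (k d) in
/-- `left (Sch X ⊗ N) ≅ X ⊗ left N`, naturally in `X` and `N`. -/
def leftTensorIso :
    schur k d ⋙ kronecker k (Equiv.Perm (Fin d)) ⋙ (Functor.whiskeringRight _ _ _).obj (left k d) ≅
      internalTensor k d ⋙ (Functor.whiskeringLeft _ _ _).obj (left k d) :=
  NatIso.ofComponents (fun X =>
    NatIso.ofComponents (fun N => isoOfFamily (dayEquiv X N) fun {V W} g x => by
      revert x
      refine LinearMap.congr_fun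
        (f := toDay X N W ∘ₗ leftMap g (𝟙 (schurTensor X N)))
        (g := dayMap (𝟙 X) (𝟙 ((left k d).obj N)) g ∘ₗ toDay X N V) ?_
      refine schurTensor_ext fun u f n => ?_
      change toDay X N W (leftMk (Hom.lin g u) (schurMk X N f n)) =
        dayMap (𝟙 X) (𝟙 ((left k d).obj N)) g (toDay X N V (leftMk u (schurMk X N f n)))
      rw [toDay_leftMk, toDay_leftMk, dayMap_dayMk, trace_comp]
      rfl)
      fun {N N'} φ => by
        ext U : 4
        refine schurTensor_ext fun u f n => ?_
        change toDay X N' U (leftMk u (schurMk X N' f (φ.hom n))) =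
          dayMap (𝟙 X) ((left k d).map φ) (𝟙 U) (toDay X N U (leftMk u (schurMk X N f n)))
        rw [toDay_leftMk, toDay_leftMk, dayMap_dayMk, Category.comp_id]
        rfl)
    fun {X X'} α => by
      ext N U : 6
      refine schurTensor_ext fun u f n => ?_
      change toDay X' N U (leftMk u (schurMk X' N (f ≫ α) n)) =
        dayMap α (𝟙 ((left k d).obj N)) (𝟙 U) (toDay X N U (leftMk u (schurMk X N f n)))
      rw [toDay_leftMk, toDay_leftMk, dayMap_dayMk, Category.comp_id]
      rfl

end SPF

/-! ### Functionals on (U ⊗ V)^{⊗ d} as sums of products. -/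

namespace DivPow

variable {k : Type u} [CommRing k] {d : ℕ}

/-- The map `(U^{⊗ d}) → (V^{⊗ d})^*` corresponding to a functional on `(U ⊗ V)^{⊗ d}`. -/
def curryDual (U V : DivPow k d) :
    Module.Dual k (tensor U V).pow ≃ₗ[k] (U.pow →ₗ[k] Module.Dual k V.pow) :=
  (zipEquiv k d U.carrier V.carrier).dualMap ≪≫ₗ
    (TensorProduct.lift.equiv (.id k) U.pow V.pow k).symm

lemma curryDual_dualTensor {U V : DivPow k d} (ξ : Module.Dual k U.pow) (η : Module.Dual k V.pow) :
    curryDual U V (dualTensor ξ η) = ξ.smulRight η :=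
  LinearMap.ext fun x => LinearMap.ext fun y => dualTensor_zipEquiv ξ η x y

/-- Linear maps out of the dual of `(U ⊗ V)^{⊗ d}` are given by their values on products. -/
def dualTensorLift {U V : DivPow k d} {P : Type*} [AddCommGroup P] [Module k P]
    (b : Module.Dual k U.pow →ₗ[k] Module.Dual k V.pow →ₗ[k] P) :
    Module.Dual k (tensor U V).pow →ₗ[k] P :=
  rankOneLift b ∘ₗ (curryDual U V).toLinearMap

lemma dualTensorLift_dualTensor {U V : DivPow k d} {P : Type*} [AddCommGroup P] [Module k P]
    (b : Module.Dual k U.pow →ₗ[k] Module.Dual k V.pow →ₗ[k] P) (ξ : Module.Dual k U.pow)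
    (η : Module.Dual k V.pow) : dualTensorLift b (dualTensor ξ η) = b ξ η := by
  rw [dualTensorLift, LinearMap.comp_apply, LinearEquiv.coe_coe, curryDual_dualTensor,
    rankOneLift_smulRight]

lemma dualTensor_ext {U V : DivPow k d} {P : Type*} [AddCommGroup P] [Module k P]
    {f g : Module.Dual k (tensor U V).pow →ₗ[k] P}
    (h : ∀ ξ η, f (dualTensor ξ η) = g (dualTensor ξ η)) : f = g := by
  have key : f ∘ₗ (curryDual U V).symm.toLinearMap = g ∘ₗ (curryDual U V).symm.toLinearMap := by
    refine rankOne_ext fun ξ η => ?_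
    rw [← curryDual_dualTensor]
    simpa using h ξ η
  refine LinearMap.ext fun ζ => ?_
  simpa using LinearMap.congr_fun key (curryDual U V ζ)

end DivPow

namespace SPF

open DivPow

variable {k : Type u} [CommRing k] {d : ℕ}

/-! ### The right adjoint and the internal hom -/

/-- The representation `Hom_k(Hom(⊗^d, X), N)`. -/
abbrev schurHom (X : SPF k d) (N : Rep.{u + 1} k (Equiv.Perm (Fin d))) :
    Rep.{u + 1} k (Equiv.Perm (Fin d)) :=
  ((repHom k (Equiv.Perm (Fin d))).obj (Opposite.op ((schur k d).obj X))).obj N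

/-- The components of a morphism `X ⟶ (right N)(U ⊗ -)`. -/
def paramApp {X : SPF k d} {N : Rep.{u + 1} k (Equiv.Perm (Fin d))} {U : DivPow k d}
    (α : X ⟶ param U ((right k d).obj N)) (V : DivPow k d) :
    X.obj.obj V →ₗ[k] Module.Dual k (tensor U V).pow →ₗ[k] N.V :=
  rightVal ∘ₗ (α.hom.app V).hom

/-- The values of `rightVal` are linear in functionals on (U ⊗ V)^{⊗ d}, and products generate
these. -/
lemma paramApp_ext {X : SPF k d} {N : Rep.{u + 1} k (Equiv.Perm (Fin d))} {U : DivPow k d}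
    {α α' : X ⟶ param U ((right k d).obj N)}
    (h : ∀ V x ξ η, paramApp α V x (dualTensor ξ η) = paramApp α' V x (dualTensor ξ η)) :
    α = α' := by
  ext V x : 5
  exact rightVal_ext fun ζ => LinearMap.congr_fun
    (f := paramApp α V x) (g := paramApp α' V x) (dualTensor_ext (h V x)) ζ

lemma paramApp_map {X : SPF k d} {N : Rep.{u + 1} k (Equiv.Perm (Fin d))} {U : DivPow k d}
    (α : X ⟶ param U ((right k d).obj N)) {V W : DivPow k d} (g : V ⟶ W) (x : X.obj.obj V)
    (ξ : Module.Dual k U.pow) (η : Module.Dual k W.pow) :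
    paramApp α W (X.obj.map g x) (dualTensor ξ η) =
      paramApp α V x (dualTensor ξ (η ∘ₗ Hom.lin g)) := by
  have h := ConcreteCategory.congr_hom (α.hom.naturality g) x
  refine (congrArg (fun b => rightVal (N := N) (V := tensor U W) b (dualTensor ξ η)) h).trans ?_
  refine (congrArg (paramApp α V x) (dualTensor_comp_tensorMap (𝟙 U) g ξ η)).trans ?_
  rw [lin_id, LinearMap.comp_id]

lemma paramApp_rho {X : SPF k d} {N : Rep.{u + 1} k (Equiv.Perm (Fin d))} {U : DivPow k d}
    (α : X ⟶ param U ((right k d).obj N)) {V : DivPow k d} (x : X.obj.obj V)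
    (ξ : Module.Dual k U.pow) (η : Module.Dual k V.pow) (σ : Equiv.Perm (Fin d)) :
    paramApp α V x (dualTensor (ξ ∘ₗ U.rho σ⁻¹) (η ∘ₗ V.rho σ⁻¹)) =
      N.ρ σ (paramApp α V x (dualTensor ξ η)) := by
  rw [← dualTensor_comp_rho]
  exact rightVal_rho (N := N) (V := tensor U V) (α.hom.app V x) (dualTensor ξ η) σ

/-- The bilinear map `(ξ, f) ↦ α(f(t))(ξ ⊗ genDual)`, where `t` is the generator
`e_1 ⊗ ⋯ ⊗ e_d`. -/
def toHomAux {X : SPF k d} {N : Rep.{u + 1} k (Equiv.Perm (Fin d))} {U : DivPow k d}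
    (α : X ⟶ param U ((right k d).obj N)) :
    Module.Dual k U.pow →ₗ[k] (tensorPower k d ⟶ X) →ₗ[k] N.V :=
  ((paramApp α (gen k d)).compl₁₂ ((evₗ X (gen k d)).flip (genVec k d))
    ((dualTensorₗ U (gen k d)).flip (genDual k d))).flip

lemma toHomAux_apply {X : SPF k d} {N : Rep.{u + 1} k (Equiv.Perm (Fin d))} {U : DivPow k d}
    (α : X ⟶ param U ((right k d).obj N)) (ξ : Module.Dual k U.pow) (f : tensorPower k d ⟶ X) :
    toHomAux α ξ f =
      paramApp α (gen k d) (ev f (gen k d) (genVec k d)) (dualTensor ξ (genDual k d)) := rfl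

/-- Naturality of α along `trace η t`, t the generator, replaces `genDual` by η. This formula is
what identifies `ofHom` as the inverse. -/
lemma toHomAux_coev {X : SPF k d} {N : Rep.{u + 1} k (Equiv.Perm (Fin d))} {U : DivPow k d}
    (α : X ⟶ param U ((right k d).obj N)) (ξ : Module.Dual k U.pow) {V : DivPow k d}
    (x : X.obj.obj V) (η : Module.Dual k V.pow) :
    toHomAux α ξ (coev x η) = paramApp α V x (dualTensor ξ η) := by
  rw [toHomAux_apply, ev_coev, paramApp_map, genDual_trace]

lemma toHomAux_rho {X : SPF k d} {N : Rep.{u + 1} k (Equiv.Perm (Fin d))} {U : DivPow k d}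
    (α : X ⟶ param U ((right k d).obj N)) (ξ : Module.Dual k U.pow) (σ : Equiv.Perm (Fin d))
    (f : tensorPower k d ⟶ X) :
    toHomAux α (ξ ∘ₗ U.rho σ⁻¹) f = N.ρ σ (toHomAux α ξ (schurRep X σ⁻¹ f)) := by
  -- With f = `coev x (genDual)`, the action of σ⁻¹ on f composes `genDual` with σ, and the
  -- simultaneous equivariance of α in both functionals composes it with σ⁻¹ again.
  rw [← coev_ev f, schurRep_coev, toHomAux_coev, toHomAux_coev, ← paramApp_rho]
  congr 2
  refine LinearMap.ext fun v => congrArg (genDual k d) ?_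
  simp

/-- The comparison map `Hom(X, (right N)(U ⊗ -)) → Hom_{S_d}((U^{⊗ d})^*, Hom(Sch X, N))`. -/
def toHom (X : SPF k d) (N : Rep.{u + 1} k (Equiv.Perm (Fin d))) (U : DivPow k d) :
    (X ⟶ param U ((right k d).obj N)) →ₗ[k] RightObj U (schurHom X N) where
  toFun α := rightMk (N := schurHom X N) (toHomAux α) fun σ ξ =>
    LinearMap.ext fun f => toHomAux_rho α ξ σ f
  map_add' _ _ := rfl
  map_smul' _ _ := rfl

/-- The underlying bilinear map of an element of `Hom_{S_d}((U^{⊗ d})^*, Hom(Sch X, N))`. -/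
def homVal {X : SPF k d} {N : Rep.{u + 1} k (Equiv.Perm (Fin d))} {U : DivPow k d}
    (g : RightObj U (schurHom X N)) :
    Module.Dual k U.pow →ₗ[k] (tensorPower k d ⟶ X) →ₗ[k] N.V := g.toLinearMap

lemma homVal_ext {X : SPF k d} {N : Rep.{u + 1} k (Equiv.Perm (Fin d))} {U : DivPow k d}
    {g g' : RightObj U (schurHom X N)}
    (h : ∀ ξ f, homVal g ξ f = homVal g' ξ f) : g = g' :=
  right_ext (N := schurHom X N) fun ξ => LinearMap.ext (h ξ)

lemma homVal_rho {X : SPF k d} {N : Rep.{u + 1} k (Equiv.Perm (Fin d))} {U : DivPow k d}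
    (g : RightObj U (schurHom X N)) (ξ : Module.Dual k U.pow) (σ : Equiv.Perm (Fin d))
    (f : tensorPower k d ⟶ X) :
    homVal g (ξ ∘ₗ U.rho σ⁻¹) f = N.ρ σ (homVal g ξ (schurRep X σ⁻¹ f)) :=
  LinearMap.congr_fun (f := homVal g (ξ ∘ₗ U.rho σ⁻¹))
    (g := N.ρ σ ∘ₗ homVal g ξ ∘ₗ schurRep X σ⁻¹) (right_hom_rho (N := schurHom X N) g ξ σ) f

/-- The linear map `ξ ⊗ η ↦ g(ξ)(coev x η)`. -/
def ofHomAux {X : SPF k d} {N : Rep.{u + 1} k (Equiv.Perm (Fin d))} {U : DivPow k d}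
    (g : RightObj U (schurHom X N)) (V : DivPow k d) (x : X.obj.obj V) :
    Module.Dual k (tensor U V).pow →ₗ[k] N.V :=
  dualTensorLift ((homVal g).compl₁₂ .id (coevₗ X V x))

lemma ofHomAux_dualTensor {X : SPF k d} {N : Rep.{u + 1} k (Equiv.Perm (Fin d))} {U : DivPow k d}
    (g : RightObj U (schurHom X N)) {V : DivPow k d} (x : X.obj.obj V)
    (ξ : Module.Dual k U.pow) (η : Module.Dual k V.pow) :
    ofHomAux g V x (dualTensor ξ η) = homVal g ξ (coev x η) := by
  rw [ofHomAux, dualTensorLift_dualTensor]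
  rfl

lemma ofHomAux_rho {X : SPF k d} {N : Rep.{u + 1} k (Equiv.Perm (Fin d))} {U : DivPow k d}
    (g : RightObj U (schurHom X N)) {V : DivPow k d} (x : X.obj.obj V) (σ : Equiv.Perm (Fin d))
    (ζ : Module.Dual k (tensor U V).pow) :
    ofHomAux g V x (ζ ∘ₗ (tensor U V).rho σ⁻¹) = N.ρ σ (ofHomAux g V x ζ) := by
  revert ζ
  refine LinearMap.congr_fun (f := ofHomAux g V x ∘ₗ LinearMap.lcomp k k ((tensor U V).rho σ⁻¹))
    (g := N.ρ σ ∘ₗ ofHomAux g V x) (dualTensor_ext fun ξ η => ?_)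
  change ofHomAux g V x (dualTensor ξ η ∘ₗ (tensor U V).rho σ⁻¹) =
    N.ρ σ (ofHomAux g V x (dualTensor ξ η))
  rw [dualTensor_comp_rho, ofHomAux_dualTensor, ofHomAux_dualTensor, homVal_rho, ← schurRep_coev,
    Representation.inv_self_apply]

/-- The inverse of `toHom`. -/
def ofHom {X : SPF k d} {N : Rep.{u + 1} k (Equiv.Perm (Fin d))} {U : DivPow k d}
    (g : RightObj U (schurHom X N)) : X ⟶ param U ((right k d).obj N) :=
  ObjectProperty.homMk
    { app V := ModuleCat.ofHom
        { toFun x := rightMk (N := N) (V := tensor U V) (ofHomAux g V x)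
            fun σ ζ => ofHomAux_rho g x σ ζ
          map_add' x y := rightVal_ext (N := N) (V := tensor U V) fun ζ =>
            LinearMap.congr_fun (f := ofHomAux g V (x + y))
              (g := ofHomAux g V x + ofHomAux g V y)
              (dualTensor_ext fun ξ η => by
                rw [LinearMap.add_apply, ofHomAux_dualTensor, ofHomAux_dualTensor,
                  ofHomAux_dualTensor, ← coevₗ_apply, map_add]
                exact map_add (homVal g ξ) _ _) ζ
          map_smul' a x := rightVal_ext (N := N) (V := tensor U V) fun ζ =>
            LinearMap.congr_fun (f := ofHomAux g V (a • x)) (g := a • ofHomAux g V x)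
              (dualTensor_ext fun ξ η => by
                rw [LinearMap.smul_apply, ofHomAux_dualTensor, ofHomAux_dualTensor, ← coevₗ_apply,
                  map_smul]
                exact map_smul (homVal g ξ) _ _) ζ }
      naturality V W f := by
        ext x : 2
        refine rightVal_ext (N := N) (V := tensor U W) fun ζ => ?_
        refine LinearMap.congr_fun (f := ofHomAux g W (X.obj.map f x))
          (g := ofHomAux g V x ∘ₗ LinearMap.lcomp k k (Hom.lin (tensorMap (𝟙 U) f)))
          (dualTensor_ext fun ξ η => ?_) ζ
        change _ = ofHomAux g V x (dualTensor ξ η ∘ₗ Hom.lin (tensorMap (𝟙 U) f))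
        rw [dualTensor_comp_tensorMap, ofHomAux_dualTensor, ofHomAux_dualTensor, coev_map, lin_id,
          LinearMap.comp_id] }

lemma paramApp_ofHom {X : SPF k d} {N : Rep.{u + 1} k (Equiv.Perm (Fin d))} {U : DivPow k d}
    (g : RightObj U (schurHom X N)) {V : DivPow k d} (x : X.obj.obj V)
    (ξ : Module.Dual k U.pow) (η : Module.Dual k V.pow) :
    paramApp (ofHom g) V x (dualTensor ξ η) = homVal g ξ (coev x η) :=
  ofHomAux_dualTensor g x ξ η

/-- The comparison isomorphism
`Hom(X, (right N)(U ⊗ -)) ≃ Hom_{S_d}((U^{⊗ d})^*, Hom(Sch X, N))`. -/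
def homEquiv (X : SPF k d) (N : Rep.{u + 1} k (Equiv.Perm (Fin d))) (U : DivPow k d) :
    (X ⟶ param U ((right k d).obj N)) ≃ₗ[k] RightObj U (schurHom X N) where
  __ := toHom X N U
  invFun := ofHom
  left_inv α := paramApp_ext fun V x ξ η => by
    rw [paramApp_ofHom]
    exact toHomAux_coev α ξ x η
  right_inv g := homVal_ext fun ξ f => by
    change toHomAux (ofHom g) ξ f = _
    rw [← coev_ev f, toHomAux_coev, paramApp_ofHom]

lemma paramApp_comp_paramMap {X : SPF k d} {N N' : Rep.{u + 1} k (Equiv.Perm (Fin d))}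
    {U U' : DivPow k d} (α : X ⟶ param U ((right k d).obj N)) (g : U ⟶ U') (φ : N ⟶ N')
    {V : DivPow k d} (x : X.obj.obj V) (ξ : Module.Dual k U'.pow) (η : Module.Dual k V.pow) :
    paramApp (N := N') (α ≫ paramMap g ((right k d).map φ)) V x (dualTensor ξ η) =
      φ.hom (paramApp α V x (dualTensor (ξ ∘ₗ Hom.lin g) η)) := by
  have h := dualTensor_comp_tensorMap g (𝟙 V) ξ η
  rw [lin_id, LinearMap.comp_id] at h
  rw [← h]
  rfl

variable (k d) in
/-- `ℍ(X, right N) ≅ right (Hom(Sch X, N))`, naturally in `X` and `N`. -/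
def rightHomIso :
    internalHom k d ⋙ (Functor.whiskeringLeft _ _ _).obj (right k d) ≅
      (schur k d).op ⋙ repHom k (Equiv.Perm (Fin d)) ⋙
        (Functor.whiskeringRight _ _ _).obj (right k d) :=
  NatIso.ofComponents (fun X =>
    NatIso.ofComponents (fun N => isoOfFamily (homEquiv X.unop N) fun {U U'} g α => by
      refine homVal_ext fun ξ f => ?_
      refine Eq.trans ?_ (paramApp_comp_paramMap (X := X.unop) α g (𝟙 N) _ ξ (genDual k d))
      change toHomAux (X := X.unop) (α ≫ paramMap g (𝟙 ((right k d).obj N))) ξ f = _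
      rw [(right k d).map_id]
      rfl)
      fun {N N'} φ => by
        ext U α : 5
        exact homVal_ext (X := X.unop) fun ξ f =>
          paramApp_comp_paramMap (X := X.unop) α (𝟙 U) φ _ ξ (genDual k d))
    fun {X X'} β => by
      ext N U α : 7
      exact homVal_ext (X := X'.unop) fun ξ f => rfl

end SPF

/-! ### Transport to arbitrary adjoints, and conclusion. -/

open SPF in
/-- The comparison isomorphisms for arbitrary adjoints of the Schur functor. -/
lemma tensor_hom_iso {k : Type u} [CommRing k] {d : ℕ}
    {L R : Rep.{u + 1} k (Equiv.Perm (Fin d)) ⥤ SPF k d} (hL : L ⊣ SPF.schur k d)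
    (hR : SPF.schur k d ⊣ R) :
    Nonempty (schur k d ⋙ kronecker k (Equiv.Perm (Fin d)) ⋙
        (Functor.whiskeringRight _ _ _).obj L ≅
      internalTensor k d ⋙ (Functor.whiskeringLeft _ _ _).obj L) ∧
    Nonempty ((schur k d).op ⋙ repHom k (Equiv.Perm (Fin d)) ⋙
        (Functor.whiskeringRight _ _ _).obj R ≅
      internalHom k d ⋙ (Functor.whiskeringLeft _ _ _).obj R) := by
  let eL : L ≅ left k d := hL.leftAdjointUniq (leftAdj k d)
  let eR : R ≅ right k d := hR.rightAdjointUniq (rightAdj k d)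
  refine ⟨⟨?_⟩, ⟨?_⟩⟩
  · exact Functor.isoWhiskerLeft (schur k d) (Functor.isoWhiskerLeft
        (kronecker k (Equiv.Perm (Fin d))) ((Functor.whiskeringRight _ _ _).mapIso eL)) ≪≫
      leftTensorIso k d ≪≫
      Functor.isoWhiskerLeft (internalTensor k d) ((Functor.whiskeringLeft _ _ _).mapIso eL.symm)
  · exact Functor.isoWhiskerLeft (schur k d).op (Functor.isoWhiskerLeft
        (repHom k (Equiv.Perm (Fin d))) ((Functor.whiskeringRight _ _ _).mapIso eR)) ≪≫
      (rightHomIso k d).symm ≪≫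
      Functor.isoWhiskerLeft (internalHom k d) ((Functor.whiskeringLeft _ _ _).mapIso eR.symm)

open SPF in
/-- Both adjoints are sections of the Schur functor. -/
lemma nonempty_comp_schur_iso {k : Type u} [CommRing k] {d : ℕ}
    {L R F : Rep.{u + 1} k (Equiv.Perm (Fin d)) ⥤ SPF k d} (hL : L ⊣ SPF.schur k d)
    (hR : SPF.schur k d ⊣ R) (hF : F = L ∨ F = R) : Nonempty (F ⋙ schur k d ≅ 𝟭 _) := by
  let eL : L ≅ left k d := hL.leftAdjointUniq (leftAdj k d)
  have hunit : IsIso hL.unit := hL.isIso_unit_of_iso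
    (Functor.isoWhiskerRight eL (schur k d) ≪≫ (asIso (leftAdj k d).unit).symm)
  rcases hF with rfl | rfl
  · exact ⟨(asIso hL.unit).symm⟩
  · have : IsIso hR.counit :=
      -- In the triple L ⊣ Sch ⊣ R, full faithfulness of L is equivalent to that of R.
      (Adjunction.Triple.isIso_unit_iff_isIso_counit ⟨hL, hR⟩).1 hunit
    exact ⟨asIso hR.counit⟩

end
end StrictPoly
open StrictPoly CategoryTheory in
theorem corollary3p5 (k : Type u) [CommRing k] (d : ℕ) :
    (SPF.schur k d).IsRightAdjoint ∧ (SPF.schur k d).IsLeftAdjoint ∧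
    ∀ (L R : Rep.{u + 1} k (Equiv.Perm (Fin d)) ⥤ SPF k d),
      (L ⊣ SPF.schur k d) → (SPF.schur k d ⊣ R) →
      -- isomorphisms natural in `N`, for all `M` and `X` with `Sch X ≅ M`
      (∀ (M : Rep.{u + 1} k (Equiv.Perm (Fin d))) (X : SPF k d),
        Nonempty ((SPF.schur k d).obj X ≅ M) →
          Nonempty ((kronecker k (Equiv.Perm (Fin d))).obj M ⋙ L ≅
            L ⋙ (SPF.internalTensor k d).obj X) ∧
          Nonempty ((repHom k (Equiv.Perm (Fin d))).obj (Opposite.op M) ⋙ R ≅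
            R ⋙ (SPF.internalHom k d).obj (Opposite.op X))) ∧
      -- isomorphisms natural in `M` and `N`, for `X = F M` with `F = L` or `F = R`
      (∀ F : Rep.{u + 1} k (Equiv.Perm (Fin d)) ⥤ SPF k d, F = L ∨ F = R →
          Nonempty (kronecker k (Equiv.Perm (Fin d)) ⋙ (Functor.whiskeringRight _ _ _).obj L ≅
            F ⋙ SPF.internalTensor k d ⋙ (Functor.whiskeringLeft _ _ _).obj L) ∧
          Nonempty (repHom k (Equiv.Perm (Fin d)) ⋙ (Functor.whiskeringRight _ _ _).obj R ≅
            F.op ⋙ SPF.internalHom k d ⋙ (Functor.whiskeringLeft _ _ _).obj R)) := by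
  refine ⟨⟨_, ⟨SPF.leftAdj k d⟩⟩, ⟨_, ⟨SPF.rightAdj k d⟩⟩, fun L R hL hR => ?_⟩
  obtain ⟨⟨eT⟩, ⟨eH⟩⟩ := tensor_hom_iso hL hR
  refine ⟨fun M X ⟨i⟩ => ⟨⟨?_⟩, ⟨?_⟩⟩, fun F hF => ?_⟩
  -- The chosen isomorphism Sch X ≅ M replaces M by Sch X; with X and M fixed, only naturality in N
  -- is available.
  · exact Functor.isoWhiskerRight ((kronecker k (Equiv.Perm (Fin d))).mapIso i.symm) L ≪≫
      eT.app X
  · exact Functor.isoWhiskerRight ((repHom k (Equiv.Perm (Fin d))).mapIso i.op) R ≪≫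
      eH.app (Opposite.op X)
  -- Here Sch(F M) ≅ M is natural in M, so the projection formulas restricted along F are natural in
  -- both variables.
  · obtain ⟨e⟩ := nonempty_comp_schur_iso hL hR hF
    refine ⟨⟨?_⟩, ⟨?_⟩⟩
    · exact (Functor.isoWhiskerRight e (kronecker k (Equiv.Perm (Fin d)) ⋙
        (Functor.whiskeringRight _ _ _).obj L)).symm ≪≫ Functor.isoWhiskerLeft F eT
    · exact Functor.isoWhiskerRight (NatIso.op e) (repHom k (Equiv.Perm (Fin d)) ⋙
        (Functor.whiskeringRight _ _ _).obj R) ≪≫ Functor.isoWhiskerLeft F.op eH
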